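/- Let $X\subset\mathbb{C}\equiv\mathbb{R}^2$ be a bounded open set (for instance a bounded domain). For $\tau>1$ and $z_0\in\mathbb{C}$ put $\Phi(z)=(z-z_0)^2$ and $$\mathcal{T}a=\overline\partial^{-1}\big(e^{-i\tau(\Phi+\overline\Phi)}a\big),\qquad \overline\partial^{-1}u(z)=\Big(\frac{1}{\pi z}*u\Big)(z)=\frac1\pi\int_{\mathbb{C}}\frac{u(w)}{z-w}\,dm(w),$$ where $a$ is a function on $X$, extended by zero to $\mathbb{C}$, and $m$ is Lebesgue measure. Let $W^{1,q}_0(X)$ be the completion of $C_0^\infty(X)$ under the norm $\|a\|_{W^{1,q}(X)}=\big(\|a\|_{L^q(X)}^q+\|\partial_1a\|_{L^q(X)}^q+\|\partial_2a\|_{L^q(X)}^q\big)^{1/q}$. Assume that $2<p^*<\infty$ and $\frac12+\frac1{p^*}\ge\frac1q>\frac12$. Then there is a constant $C$, depending only on $p^*$, $q$ and $X$, such that for all $\tau>1$ and $z_0\in\mathbb{C}$ the operator $\mathcal{T}$, defined on $C_0^\infty(X)$, extends to a bounded linear map $\mathcal{T}:W^{1,q}_0(X)\to L^{p^*}(X)$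 with $$\|\mathcal{T}a\|_{L^{p^*}(X)}\le C\,\tau^{1/q-1-1/p^*}\,\|a\|_{W^{1,q}(X)}\qquad\text{for all }a\in W^{1,q}_0(X),$$ and for every $a\in W^{1,q}_0(X)$ this extension is given by the integral above, which converges absolutely for almost every $z\in X$. -/

import Mathlib

open MeasureTheory TopologicalSpace
open scoped ENNReal Distributions Convolution

noncomputable section

/-- The Cauchy operator `u ↦ (1 / (π z)) * u`, i.e.
`cauchyOp u z = ∫ u (w) / (π (z - w)) dm(w)`, for (compactly supported) functions `u` on the
plane `ℂ = ℝ²`; `volume` is the two-dimensional Lebesgue measure. -/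
def cauchyOp (u : ℂ → ℂ) : ℂ → ℂ :=
  (fun z : ℂ => 1 / ((Real.pi : ℂ) * z)) ⋆[ContinuousLinearMap.mul ℂ ℂ, volume] u

/-- The absolute convergence of the integral that defines `cauchyOp u z`. -/
def CauchyOpExistsAt (u : ℂ → ℂ) (z : ℂ) : Prop :=
  ConvolutionExistsAt (fun z : ℂ => 1 / ((Real.pi : ℂ) * z)) u z (ContinuousLinearMap.mul ℂ ℂ) volume

/-- The phase `Φ (z) = (z - z₀)²`. -/
def phase (z₀ z : ℂ) : ℂ := (z - z₀) ^ 2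

/-- The function `exp (-i τ (Φ + conj Φ)) a`. -/
def modulate (τ : ℝ) (z₀ : ℂ) (a : ℂ → ℂ) (z : ℂ) : ℂ :=
  Complex.exp (-Complex.I * (τ : ℂ) * (phase z₀ z + (starRingEnd ℂ) (phase z₀ z))) * a z

/-- The conjugated Cauchy operator `a ↦ ∂̄⁻¹ (exp (-i τ (Φ + conj Φ)) a)`. -/
def conjCauchyOp (τ : ℝ) (z₀ : ℂ) (a : ℂ → ℂ) : ℂ → ℂ := cauchyOp (modulate τ z₀ a)

/-- The space `L^p(X)` of complex valued functions. -/
abbrev LpOn (p : ℝ≥0∞) (X : Opens ℂ) : Type := Lp ℂ p (volume.restrict (X : Set ℂ))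

/-- A function together with its two first order partial derivatives: the `j`-th entry of
`jet φ` is `φ`, `∂₁ φ`, `∂₂ φ` for `j = 0, 1, 2` (with the coordinates `z = x₁ + i x₂`). -/
def jet (φ : ℂ → ℂ) : Fin 3 → ℂ → ℂ :=
  ![φ, fun z => fderiv ℝ φ z 1, fun z => fderiv ℝ φ z Complex.I]

theorem jet_memLp {X : Opens ℂ} (q : ℝ≥0∞) (φ : 𝓓(X, ℂ)) (j : Fin 3) :
    MemLp (jet φ j) q (volume.restrict (X : Set ℂ)) := by
  have hd : Continuous (fderiv ℝ φ) := φ.contDiff.continuous_fderiv (by simp)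
  have hs : HasCompactSupport (fderiv ℝ φ) := φ.hasCompactSupport.fderiv ℝ
  have key : ∀ v : ℂ, MemLp (fun z => fderiv ℝ φ z v) q (volume.restrict (X : Set ℂ)) := fun v =>
    (hd.clm_apply continuous_const).memLp_of_hasCompactSupport
      (hs.comp_left (g := fun L : ℂ →L[ℝ] ℂ => L v) (by simp))
  fin_cases j
  · exact φ.continuous.memLp_of_hasCompactSupport φ.hasCompactSupport
  · exact key 1
  · exact key Complex.I

theorem jet_add {X : Opens ℂ} (φ ψ : 𝓓(X, ℂ)) (j : Fin 3) :
    jet (⇑(φ + ψ)) j = jet φ j + jet ψ j := by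
  have hφ : Differentiable ℝ φ := φ.contDiff.differentiable (by simp)
  have hψ : Differentiable ℝ ψ := ψ.contDiff.differentiable (by simp)
  have h : ⇑(φ + ψ) = (φ : ℂ → ℂ) + ψ := rfl
  funext z
  fin_cases j <;> simp [jet, h, fderiv_add (hφ z) (hψ z)]

theorem jet_smul {X : Opens ℂ} (c : ℂ) (φ : 𝓓(X, ℂ)) (j : Fin 3) :
    jet (⇑(c • φ)) j = c • jet φ j := by
  have hφ : Differentiable ℝ φ := φ.contDiff.differentiable (by simp)
  have h : ⇑(c • φ) = c • (φ : ℂ → ℂ) := rfl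
  funext z
  fin_cases j <;> simp [jet, h, fderiv_const_smul (hφ z) c]

/-- `C₀^∞(X)` inside `L^q(X)³`, through `φ ↦ (φ, ∂₁ φ, ∂₂ φ)`. The norm of `PiLp q` is
`(‖u₀‖_q ^ q + ‖u₁‖_q ^ q + ‖u₂‖_q ^ q) ^ (1 / q)` for `q < ∞`, so that the norm of the image
of `φ` is the `W^{1,q}(X)`-norm of `φ`. -/
def sobolevEmbed (q : ℝ≥0∞) [Fact (1 ≤ q)] (X : Opens ℂ) :
    𝓓(X, ℂ) →ₗ[ℂ] PiLp q (fun _ : Fin 3 => LpOn q X) where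
  toFun φ := WithLp.toLp q fun j => (jet_memLp q φ j).toLp (jet φ j)
  map_add' φ ψ := by
    ext1 j
    simp only [jet_add, PiLp.add_apply]
    exact MemLp.toLp_add (jet_memLp q φ j) (jet_memLp q ψ j)
  map_smul' c φ := by
    ext1 j
    simp only [jet_smul, PiLp.smul_apply, RingHom.id_apply]
    exact MemLp.toLp_const_smul c (jet_memLp q φ j)

/-- The space `W₀^{1,q}(X)`: the completion of `C₀^∞(X)` under the `W^{1,q}(X)`-norm, realized as
the closure of its isometric image in the Banach space `L^q(X)³`. An element is a function
`u 0 ∈ L^q(X)` together with its weak partial derivatives `u 1`, `u 2`. -/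
abbrev W10 (q : ℝ≥0∞) [Fact (1 ≤ q)] (X : Opens ℂ) :
    Submodule ℂ (PiLp q (fun _ : Fin 3 => LpOn q X)) :=
  (LinearMap.range (sobolevEmbed q X)).topologicalClosure

/-- A test function as an element of `W₀^{1,q}(X)`. -/
def W10.ofTest (q : ℝ≥0∞) [Fact (1 ≤ q)] (X : Opens ℂ) (φ : 𝓓(X, ℂ)) : W10 q X :=
  ⟨sobolevEmbed q X φ, Submodule.le_topologicalClosure _ ⟨φ, rfl⟩⟩

/-- The function on the plane that underlies an element of `W₀^{1,q}(X)`, extended by zero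
outside `X`. -/
def extendByZero {q : ℝ≥0∞} [Fact (1 ≤ q)] {X : Opens ℂ} (u : W10 q X) : ℂ → ℂ :=
  (X : Set ℂ).indicator (u.1 0 : LpOn q X)

end

/-! Write E = exp(-iτ(Φ + conj Φ)), a = 1/p*, b = 1/q. Since ∂̄E = -2iτ conj(z - z₀) E, integrating
by parts gains a factor 1/τ at the price of dividing by conj(z - z₀). That quotient is too singular
at z₀, so it is replaced by m = (z - z₀)/(|z - z₀|² + r²) with r = τ^(-1/2). For a test function φ
the Cauchy–Pompeiu formula (`cauchyOp_dbar`) then gives 𝒯φ = (i/2τ) E m φ + ∂̄⁻¹h, where |h| ≤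
(1/2τ)(3w²|φ| + w|∂̄φ|) and w = (|z - z₀|² + r²)^(-1/2) ≥ |m| (`norm_modulate_sub_dbar_le`).

Three inequalities finish the estimate on test functions (`exists_eLpNorm_conjCauchyOp_le`).
Hardy–Littlewood–Sobolev bounds ∂̄⁻¹ from the Lebesgue space of reciprocal exponent 1/2 + a to that
of reciprocal exponent a. Sobolev puts φ in reciprocal exponent b - 1/2. Hölder absorbs the weights,
whose norm in reciprocal exponent θ ∈ [0, 1/2) is at most a constant times r^(2θ-1). In each term
the weights cost r^(2(a-b)) = τ^(b-a), so the total is τ^(b-1-a). Here b ≤ 1/2 + a keeps θ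
nonnegative, while a < 1/2 < b makes θ < 1/2.

Hardy–Littlewood–Sobolev is itself proved (`lintegral_rpow_rieszPotential_le`): cutting the
potential at a radius depending on the level shows that a power of it satisfies the weak-type
inequality of a maximal function.

Finally, for fixed τ the integral operator is bounded on W₀^{1,q}(X) without decay, because L^q(X)
embeds in the space of reciprocal exponent 1/2 + a when X is bounded (`exists_conjCauchyOp_clm`).
Both sides of the decay estimate are thus continuous, and density of test functions carries it over.
-/

/-! ### Radial integrals in the plane and a weak-to-strong type principle -/

theorem lintegral_comp_norm_complex {g : ℝ → ℝ≥0∞} (hg : Measurable g) :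
    ∫⁻ z : ℂ, g ‖z‖ =
      ENNReal.ofReal (2 * Real.pi) * ∫⁻ r in Set.Ioi (0 : ℝ), ENNReal.ofReal r * g r := by
  rw [← Complex.lintegral_comp_polarCoord_symm, polarCoord_target,
    Measure.volume_eq_prod, ← Measure.prod_restrict]
  have h : ∀ᵐ p : ℝ × ℝ ∂((volume.restrict (Set.Ioi (0 : ℝ))).prod
      (volume.restrict (Set.Ioo (-Real.pi) Real.pi))),
      ENNReal.ofReal p.1 • g ‖Complex.polarCoord.symm p‖ = ENNReal.ofReal p.1 * g p.1 := by
    rw [Measure.prod_restrict]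
    filter_upwards [ae_restrict_mem (measurableSet_Ioi.prod measurableSet_Ioo)] with p hp
    rw [Complex.norm_polarCoord_symm, abs_of_pos hp.1, smul_eq_mul]
  rw [lintegral_congr_ae h, lintegral_prod _ (by fun_prop)]
  simp only [lintegral_const, Measure.restrict_apply_univ, Real.volume_Ioo]
  rw [lintegral_mul_const _ (by fun_prop), mul_comm]
  congr 2
  ring

theorem setLIntegral_ball_enorm_inv (ρ : ℝ) :
    ∫⁻ t in Metric.ball (0 : ℂ) ρ, ‖t‖ₑ⁻¹ ≤ ENNReal.ofReal (2 * Real.pi * ρ) := by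
  have h : ∫⁻ t in Metric.ball (0 : ℂ) ρ, ‖t‖ₑ⁻¹
      = ∫⁻ t : ℂ, (Set.Iio ρ).indicator (fun r : ℝ => (ENNReal.ofReal r)⁻¹) ‖t‖ := by
    rw [← lintegral_indicator measurableSet_ball]
    refine lintegral_congr fun t => ?_
    by_cases ht : ‖t‖ < ρ <;> simp [Set.indicator, ht]
  rw [h, lintegral_comp_norm_complex
    (Measurable.indicator (by fun_prop) measurableSet_Iio),
    ENNReal.ofReal_mul (p := 2 * Real.pi) (by positivity)]
  refine mul_le_mul' le_rfl ?_
  calc _ ≤ ∫⁻ r in Set.Ioi (0 : ℝ), (Set.Iio ρ).indicator 1 r := by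
        refine setLIntegral_mono (measurable_one.indicator measurableSet_Iio) fun r _ => ?_
        by_cases hr : r < ρ
        · simp [hr, ENNReal.mul_inv_le_one]
        · simp [hr]
    _ = ENNReal.ofReal ρ := by
        rw [lintegral_indicator_one measurableSet_Iio, Measure.restrict_apply measurableSet_Iio,
          Set.Iio_inter_Ioi, Real.volume_Ioo, sub_zero]

theorem setLIntegral_compl_ball_enorm_inv_rpow {ρ b : ℝ} (hρ : 0 < ρ) (hb : 2 < b) :
    ∫⁻ t in (Metric.ball (0 : ℂ) ρ)ᶜ, (‖t‖ₑ⁻¹) ^ b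
      ≤ ENNReal.ofReal (2 * Real.pi / (b - 2) * ρ ^ (2 - b)) := by
  have h : ∫⁻ t in (Metric.ball (0 : ℂ) ρ)ᶜ, (‖t‖ₑ⁻¹) ^ b
      = ∫⁻ t : ℂ, (Set.Ici ρ).indicator (fun r : ℝ => ((ENNReal.ofReal r)⁻¹) ^ b) ‖t‖ := by
    rw [← lintegral_indicator measurableSet_ball.compl]
    refine lintegral_congr fun t => ?_
    by_cases ht : ‖t‖ < ρ <;> simp [Set.indicator, ht, not_le]
  rw [h, lintegral_comp_norm_complex
    (Measurable.indicator (by fun_prop) measurableSet_Ici), div_mul_eq_mul_div, mul_div_assoc,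
    ENNReal.ofReal_mul (p := 2 * Real.pi) (by positivity)]
  refine mul_le_mul' le_rfl ?_
  have h1 : ∀ r : ℝ, ENNReal.ofReal r *
      (Set.Ici ρ).indicator (fun r : ℝ => ((ENNReal.ofReal r)⁻¹) ^ b) r
      = (Set.Ici ρ).indicator (fun r : ℝ => ENNReal.ofReal (r ^ (1 - b))) r := by
    intro r
    by_cases hr : ρ ≤ r
    · have hr0 : 0 < r := hρ.trans_le hr
      simp only [Set.mem_Ici, hr, Set.indicator_of_mem]
      rw [← ENNReal.ofReal_inv_of_pos hr0, ENNReal.ofReal_rpow_of_pos (by positivity),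
        ← ENNReal.ofReal_mul hr0.le, Real.inv_rpow hr0.le, Real.rpow_sub hr0, Real.rpow_one]
      rfl
    · simp [hr]
  simp_rw [h1]
  rw [lintegral_indicator measurableSet_Ici, Measure.restrict_restrict measurableSet_Ici,
    Set.inter_eq_left.2 (Set.Ici_subset_Ioi.2 hρ), setLIntegral_congr Ioi_ae_eq_Ici.symm,
    ← ofReal_integral_eq_lintegral_ofReal (integrableOn_Ioi_rpow_of_lt (by linarith) hρ)
      ((ae_restrict_mem measurableSet_Ioi).mono fun x hx =>
        Real.rpow_nonneg (hρ.trans hx).le _), integral_Ioi_rpow_of_lt (by linarith) hρ]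
  refine ENNReal.ofReal_le_ofReal (le_of_eq ?_)
  rw [show 1 - b + 1 = 2 - b by ring, ← neg_sub b 2, div_neg, neg_div, neg_neg]

/-- The inner integral left by Tonelli in the layer-cake argument: only levels t < y contribute, and
t^(p-2) is integrable at 0 because p > 1. -/
theorem mul_lintegral_rpow_sub_two_le {p : ℝ} (hp : 1 < p) (y : ℝ≥0∞) :
    ∫⁻ t in Set.Ioi (0 : ℝ), ENNReal.ofReal (t ^ (p - 2)) *
        (Set.Iio y).indicator (fun _ => y) (ENNReal.ofReal t)
      ≤ ENNReal.ofReal (1 / (p - 1)) * y ^ p := by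
  have hp0 : 0 < p - 1 := sub_pos.2 hp
  induction y with
  | top =>
    rw [ENNReal.top_rpow_of_pos (by linarith), ENNReal.mul_top]
    · exact le_top
    · simpa using hp
  | coe y =>
    have h : ∀ t ∈ Set.Ioi (0 : ℝ), ENNReal.ofReal (t ^ (p - 2)) *
        (Set.Iio (y : ℝ≥0∞)).indicator (fun _ => (y : ℝ≥0∞)) (ENNReal.ofReal t)
        = (Set.Iio (y : ℝ)).indicator (fun t => ENNReal.ofReal (t ^ (p - 2)) * y) t := by
      intro t ht
      have : ENNReal.ofReal t < y ↔ t < y := by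
        rw [← ENNReal.ofReal_coe_nnreal, ENNReal.ofReal_lt_ofReal_iff_of_nonneg (le_of_lt ht)]
      by_cases hty : t < y <;> simp [Set.indicator, this, hty]
    rw [setLIntegral_congr_fun measurableSet_Ioi h, lintegral_indicator measurableSet_Iio,
      Measure.restrict_restrict measurableSet_Iio, Set.Iio_inter_Ioi,
      lintegral_mul_const _ (by fun_prop)]
    have hint := (intervalIntegral.intervalIntegrable_rpow' (a := 0) (b := y)
      (show -1 < p - 2 by linarith)).1
    have hI : ∫⁻ t in Set.Ioo (0 : ℝ) y, ENNReal.ofReal (t ^ (p - 2))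
        = ENNReal.ofReal ((y : ℝ) ^ (p - 1) / (p - 1)) := by
      rw [setLIntegral_congr Ioo_ae_eq_Ioc, ← ofReal_integral_eq_lintegral_ofReal hint
        ((ae_restrict_mem measurableSet_Ioc).mono fun x hx => Real.rpow_nonneg hx.1.le _),
        ← intervalIntegral.integral_of_le y.coe_nonneg, integral_rpow (Or.inl (by linarith))]
      rw [show p - 2 + 1 = p - 1 by ring, Real.zero_rpow hp0.ne', sub_zero]
    rw [hI, ← ENNReal.ofReal_coe_nnreal, ENNReal.ofReal_rpow_of_nonneg y.coe_nonneg (by linarith),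
      ← ENNReal.ofReal_mul (by positivity), ← ENNReal.ofReal_mul (by positivity)]
    refine ENNReal.ofReal_le_ofReal (le_of_eq ?_)
    rcases eq_or_ne y 0 with rfl | hy
    · simp [Real.zero_rpow (by linarith : p ≠ 0)]
    · rw [Real.rpow_sub_one (by exact_mod_cast hy)]
      have : (y : ℝ) ≠ 0 := by exact_mod_cast hy
      field_simp

/-- The hypothesis is the weak-type bound typical of maximal functions. Since only the part of f
above the level s enters, inserting it in the layer-cake formula and exchanging integrals gives the
strong L^p bound. -/
theorem lintegral_rpow_le_of_meas_lt_le {α : Type*} [MeasurableSpace α] {μ : Measure α} [SFinite μ]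
    {f G : α → ℝ≥0∞} (hf : Measurable f) (hG : Measurable G) {p : ℝ} (hp : 1 < p)
    (h : ∀ s : ℝ, 0 < s → μ {x | ENNReal.ofReal s < G x}
      ≤ (ENNReal.ofReal s)⁻¹ * ∫⁻ x in {x | ENNReal.ofReal s < f x}, f x ∂μ) :
    ∫⁻ x, G x ^ p ∂μ ≤ ENNReal.ofReal (p / (p - 1)) * ∫⁻ x, f x ^ p ∂μ := by
  have hp0 : 0 < p - 1 := sub_pos.2 hp
  by_cases hfin : ∫⁻ x, f x ^ p ∂μ = ∞
  · rw [hfin, ENNReal.mul_top (by simp; positivity)]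
    exact le_top
  have hms : ∀ s : ℝ, MeasurableSet {x | ENNReal.ofReal s < f x} := fun s =>
    measurableSet_lt measurable_const hf
  -- The layer-cake formula is applied to real values, so G must be finite almost everywhere. On {f
  -- > s} one has f ≤ s^(1-p) f^p, so {G = ∞} has measure at most s^(-p) ∫ f^p, which tends to 0 as
  -- s → ∞.
  have htop : ∀ᵐ x ∂μ, G x < ∞ := by
    have hle : ∀ s : ℝ, 0 < s → μ {x | ¬ G x < ∞} ≤
        ENNReal.ofReal (s ^ (-p)) * ∫⁻ x, f x ^ p ∂μ := by
      intro s hs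
      have hs' : ENNReal.ofReal s ≠ 0 := by simpa using hs
      calc μ {x | ¬ G x < ∞} ≤ μ {x | ENNReal.ofReal s < G x} :=
            measure_mono fun x hx => ENNReal.ofReal_lt_top.trans_le (not_lt.1 hx)
        _ ≤ _ := h s hs
        _ ≤ (ENNReal.ofReal s)⁻¹ * ∫⁻ x in {x | ENNReal.ofReal s < f x},
              ENNReal.ofReal (s ^ (1 - p)) * f x ^ p ∂μ := by
            refine mul_le_mul' le_rfl (setLIntegral_mono (by fun_prop) fun x hx => ?_)
            have hx' : ENNReal.ofReal s < f x := hx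
            rw [← ENNReal.ofReal_rpow_of_pos hs]
            calc f x = ENNReal.ofReal s ^ (1 - p) * ENNReal.ofReal s ^ (p - 1) * f x := by
                  rw [← ENNReal.rpow_add _ _ hs' ENNReal.ofReal_ne_top]; simp
              _ ≤ ENNReal.ofReal s ^ (1 - p) * f x ^ (p - 1) * f x := by gcongr
              _ = _ := by
                  rw [mul_assoc]
                  congr 1
                  nth_rewrite 2 [← ENNReal.rpow_one (f x)]
                  rw [← ENNReal.rpow_add_of_nonneg _ _ hp0.le zero_le_one, sub_add_cancel]
        _ ≤ (ENNReal.ofReal s)⁻¹ * ∫⁻ x, ENNReal.ofReal (s ^ (1 - p)) * f x ^ p ∂μ :=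
            mul_le_mul' le_rfl (setLIntegral_le_lintegral _ _)
        _ = _ := by
            rw [lintegral_const_mul _ (by fun_prop), ← mul_assoc, ← ENNReal.ofReal_inv_of_pos hs,
              ← ENNReal.ofReal_mul (by positivity)]
            congr 2
            rw [← Real.rpow_neg_one, ← Real.rpow_add hs]
            congr 1; ring
    have hlim : Filter.Tendsto (fun s : ℝ => ENNReal.ofReal (s ^ (-p)) * ∫⁻ x, f x ^ p ∂μ)
        Filter.atTop (nhds (ENNReal.ofReal 0 * ∫⁻ x, f x ^ p ∂μ)) :=
      ENNReal.Tendsto.mul_const (ENNReal.tendsto_ofReal (tendsto_rpow_neg_atTop (by linarith)))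
        (Or.inr hfin)
    rw [ENNReal.ofReal_zero, zero_mul] at hlim
    rw [ae_iff]
    exact le_antisymm (ge_of_tendsto hlim
      ((Filter.eventually_gt_atTop 0).mono hle)) zero_le
  calc ∫⁻ x, G x ^ p ∂μ = ∫⁻ x, ENNReal.ofReal ((G x).toReal ^ p) ∂μ := by
        refine lintegral_congr_ae (htop.mono fun x hx => ?_)
        simp only
        rw [← ENNReal.ofReal_rpow_of_nonneg (by positivity) (by linarith),
          ENNReal.ofReal_toReal hx.ne]
    _ = ENNReal.ofReal p * ∫⁻ t in Set.Ioi 0, μ {a | t < (G a).toReal} *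
          ENNReal.ofReal (t ^ (p - 1)) :=
        lintegral_rpow_eq_lintegral_meas_lt_mul μ (ae_of_all _ fun x => ENNReal.toReal_nonneg)
          (by fun_prop) (by linarith)
    _ ≤ ENNReal.ofReal p * ∫⁻ t in Set.Ioi (0 : ℝ), ∫⁻ x, ENNReal.ofReal (t ^ (p - 2)) *
          (Set.Iio (f x)).indicator (fun _ => f x) (ENNReal.ofReal t) ∂μ := by
        refine mul_le_mul' le_rfl (setLIntegral_mono' measurableSet_Ioi fun t ht => ?_)
        have ht : 0 < t := ht
        have hind : ∀ x, (Set.Iio (f x)).indicator (fun _ => f x) (ENNReal.ofReal t)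
            = {x | ENNReal.ofReal t < f x}.indicator f x := fun x => by
          by_cases hx : ENNReal.ofReal t < f x <;> simp [Set.indicator, hx]
        simp_rw [hind]
        rw [lintegral_const_mul _ (hf.indicator (hms t)), lintegral_indicator (hms t)]
        calc _ ≤ ((ENNReal.ofReal t)⁻¹ * ∫⁻ x in {x | ENNReal.ofReal t < f x}, f x ∂μ) *
              ENNReal.ofReal (t ^ (p - 1)) := by
              refine mul_le_mul' (le_trans (measure_mono fun x hx => ?_) (h t ht)) le_rfl
              have hx : t < (G x).toReal := hx
              exact (ENNReal.ofReal_lt_iff_lt_toReal ht.le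
                fun h => by simp [h, ht.not_gt] at hx).2 hx
          _ = _ := by
              rw [mul_right_comm, ← ENNReal.ofReal_inv_of_pos ht,
                ← ENNReal.ofReal_mul (by positivity)]
              congr 2
              rw [← Real.rpow_neg_one, ← Real.rpow_add ht]
              congr 1; ring
    _ = ENNReal.ofReal p * ∫⁻ x, (∫⁻ t in Set.Ioi (0 : ℝ), ENNReal.ofReal (t ^ (p - 2)) *
          (Set.Iio (f x)).indicator (fun _ => f x) (ENNReal.ofReal t)) ∂μ := by
        rw [lintegral_lintegral_swap]
        refine Measurable.aemeasurable (Measurable.mul (by fun_prop) ?_)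
        have : (fun z : ℝ × α => (Set.Iio (f z.2)).indicator (fun _ => f z.2) (ENNReal.ofReal z.1))
            = {z : ℝ × α | ENNReal.ofReal z.1 < f z.2}.indicator fun z => f z.2 := by
          ext z; simp [Set.indicator]
        exact this ▸ (hf.comp measurable_snd).indicator
          (measurableSet_lt (by fun_prop) (hf.comp measurable_snd))
    _ ≤ ENNReal.ofReal p * ∫⁻ x, ENNReal.ofReal (1 / (p - 1)) * f x ^ p ∂μ := by
        gcongr with x
        exact mul_lintegral_rpow_sub_two_le hp (f x)
    _ = _ := by
        rw [lintegral_const_mul _ (by fun_prop), ← mul_assoc, ← ENNReal.ofReal_mul (by linarith)]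
        congr 2; ring

/-! ### The Riesz potential and the Hardy–Littlewood–Sobolev inequality -/

/-- The planar Riesz potential of order one (without normalizing constant). -/
noncomputable def rieszPotential (f : ℂ → ℝ≥0∞) (z : ℂ) : ℝ≥0∞ := ∫⁻ t, ‖t‖ₑ⁻¹ * f (z - t)

theorem measurable_rieszPotential {f : ℂ → ℝ≥0∞} (hf : Measurable f) :
    Measurable (rieszPotential f) :=
  Measurable.lintegral_prod_right' (f := fun x : ℂ × ℂ => ‖x.2‖ₑ⁻¹ * f (x.1 - x.2)) (by fun_prop)

theorem rieszPotential_congr {f g : ℂ → ℝ≥0∞} (h : f =ᵐ[volume] g) (z : ℂ) :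
    rieszPotential f z = rieszPotential g z := by
  refine lintegral_congr_ae ?_
  filter_upwards [(quasiMeasurePreserving_sub_left volume z).ae_eq_comp h] with t ht
  simp only [Function.comp_apply] at ht
  rw [ht]

theorem rieszPotential_const_mul {c : ℝ≥0∞} (hc : c ≠ ∞) (f : ℂ → ℝ≥0∞) (z : ℂ) :
    rieszPotential (fun w => c * f w) z = c * rieszPotential f z := by
  simp only [rieszPotential]
  rw [← lintegral_const_mul' _ _ hc]
  simp_rw [mul_left_comm]

theorem rieszPotential_mono {f g : ℂ → ℝ≥0∞} (h : ∀ z, f z ≤ g z) (z : ℂ) :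
    rieszPotential f z ≤ rieszPotential g z :=
  lintegral_mono fun _ => mul_le_mul' le_rfl (h _)

/-- The far part of the kernel is handled by Hölder against the normalized f, the near part by
cutting f at height s. What remains is the near potential of the part of f above s. The bound 2π ≤ A
is what the later Chebyshev step uses. -/
theorem rieszPotential_le_split {p : ℝ} (hp : 1 < p) (hp2 : p < 2) : ∃ A : ℝ, 2 * Real.pi ≤ A ∧
    ∀ f : ℂ → ℝ≥0∞, Measurable f → ∫⁻ z, f z ^ p ≤ 1 → ∀ s : ℝ, 0 < s → ∀ z,
      rieszPotential f z ≤ ENNReal.ofReal (A * s ^ (1 - p / 2)) +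
        ∫⁻ t in Metric.ball (0 : ℂ) (s ^ (-p / 2)), ‖t‖ₑ⁻¹ *
          {w | ENNReal.ofReal s < f w}.indicator f (z - t) := by
  set b := p.conjExponent with hb
  have hpb : p.HolderConjugate b := Real.HolderConjugate.conjExponent hp
  have hb2 : 2 < b := by
    rw [hb, Real.conjExponent, lt_div_iff₀ (by linarith)]; linarith
  refine ⟨2 * Real.pi + (2 * Real.pi / (b - 2)) ^ (1 / b), ?_, ?_⟩
  · have : 0 ≤ 2 * Real.pi / (b - 2) := div_nonneg (by positivity) (by linarith)
    have := Real.rpow_nonneg this (1 / b)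
    linarith
  intro f hf hf1 s hs z
  -- This radius balances the two controlled pieces: ρ s from the bounded near part and ρ^((2-b)/b)
  -- from the far part both equal s^(1-p/2).
  set ρ := s ^ (-p / 2) with hρdef
  have hρ : 0 < ρ := Real.rpow_pos_of_pos hs _
  have hc : 0 ≤ 2 * Real.pi / (b - 2) := div_nonneg (by positivity) (by linarith)
  have hms : MeasurableSet {w | ENNReal.ofReal s < f w} := measurableSet_lt measurable_const hf
  have hfar : ∫⁻ t in (Metric.ball (0 : ℂ) ρ)ᶜ, ‖t‖ₑ⁻¹ * f (z - t)
      ≤ ENNReal.ofReal ((2 * Real.pi / (b - 2)) ^ (1 / b) * s ^ (1 - p / 2)) := by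
    calc _ ≤ (∫⁻ t in (Metric.ball (0 : ℂ) ρ)ᶜ, (‖t‖ₑ⁻¹) ^ b) ^ (1 / b) *
          (∫⁻ t in (Metric.ball (0 : ℂ) ρ)ᶜ, f (z - t) ^ p) ^ (1 / p) :=
          ENNReal.lintegral_mul_le_Lp_mul_Lq _ hpb.symm (by fun_prop) (by fun_prop)
      _ ≤ (ENNReal.ofReal (2 * Real.pi / (b - 2) * ρ ^ (2 - b))) ^ (1 / b) * 1 ^ (1 / p) := by
          have hb0 : 0 < b := by linarith
          gcongr
          · exact setLIntegral_compl_ball_enorm_inv_rpow hρ hb2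
          · refine (setLIntegral_le_lintegral _ _).trans ?_
            rw [lintegral_sub_left_eq_self (fun w => f w ^ p) z]
            exact hf1
      _ = _ := by
          rw [ENNReal.one_rpow, mul_one, ENNReal.ofReal_rpow_of_nonneg (by positivity)
            (by positivity), Real.mul_rpow hc (by positivity), hρdef, ← Real.rpow_mul hs.le,
            ← Real.rpow_mul hs.le]
          congr 3
          rw [hb, Real.conjExponent]
          have : p - 1 ≠ 0 := by linarith
          field_simp
          ring
  have hnear : ∫⁻ t in Metric.ball (0 : ℂ) ρ, ‖t‖ₑ⁻¹ * f (z - t)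
      ≤ ENNReal.ofReal (2 * Real.pi * s ^ (1 - p / 2)) + ∫⁻ t in Metric.ball (0 : ℂ) ρ, ‖t‖ₑ⁻¹ *
          {w | ENNReal.ofReal s < f w}.indicator f (z - t) := by
    calc _ ≤ ∫⁻ t in Metric.ball (0 : ℂ) ρ, (‖t‖ₑ⁻¹ * ENNReal.ofReal s + ‖t‖ₑ⁻¹ *
          {w | ENNReal.ofReal s < f w}.indicator f (z - t)) := by
          refine lintegral_mono fun t => ?_
          simp only
          rw [← mul_add]
          gcongr
          by_cases h : ENNReal.ofReal s < f (z - t)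
          · simp [Set.indicator, h]
          · simp only [Set.indicator, Set.mem_ofPred_eq, h, if_false, add_zero]
            exact not_lt.1 h
      _ = (∫⁻ t in Metric.ball (0 : ℂ) ρ, ‖t‖ₑ⁻¹) * ENNReal.ofReal s + _ := by
          rw [lintegral_add_left (by fun_prop), lintegral_mul_const _ (by fun_prop)]
      _ ≤ ENNReal.ofReal (2 * Real.pi * ρ) * ENNReal.ofReal s + _ := by
          gcongr
          exact setLIntegral_ball_enorm_inv ρ
      _ = _ := by
          rw [← ENNReal.ofReal_mul (by positivity), mul_assoc, hρdef, ← Real.rpow_add_one hs.ne']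
          congr 4
          ring
  rw [rieszPotential, ← lintegral_add_compl _ (measurableSet_ball (x := (0 : ℂ)) (ε := ρ)), add_mul,
    ENNReal.ofReal_add (by positivity) (by positivity), add_right_comm]
  exact add_le_add hnear hfar

/-- Chebyshev on the uncontrolled near part, whose integral is at most 2πρ ∫_{f > s} f by Tonelli
and translation invariance. -/
theorem volume_lt_rieszPotential_le {p : ℝ} (hp : 1 < p) (hp2 : p < 2) : ∃ A : ℝ, 0 < A ∧
    ∀ f : ℂ → ℝ≥0∞, Measurable f → ∫⁻ z, f z ^ p ≤ 1 → ∀ s : ℝ, 0 < s →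
      volume {z | ENNReal.ofReal (A * s ^ (1 - p / 2)) < rieszPotential f z} ≤
        (ENNReal.ofReal s)⁻¹ * ∫⁻ z in {z | ENNReal.ofReal s < f z}, f z := by
  obtain ⟨A, hA, h⟩ := rieszPotential_le_split hp hp2
  have hA0 : 0 < A := lt_of_lt_of_le (by positivity) hA
  -- Half of the doubled threshold pays for the controlled pieces; the other half must then be
  -- reached by the near part H.
  refine ⟨2 * A, by positivity, fun f hf hf1 s hs => ?_⟩
  set ρ := s ^ (-p / 2) with hρdef
  have hms : MeasurableSet {w | ENNReal.ofReal s < f w} := measurableSet_lt measurable_const hf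
  set g := {w | ENNReal.ofReal s < f w}.indicator f with hg
  have hgm : Measurable g := hf.indicator hms
  set H : ℂ → ℝ≥0∞ := fun z => ∫⁻ t in Metric.ball (0 : ℂ) ρ, ‖t‖ₑ⁻¹ * g (z - t) with hH
  have hL : 0 < A * s ^ (1 - p / 2) := by positivity
  have hHm : Measurable H := Measurable.lintegral_prod_right'
    (f := fun x : ℂ × ℂ => ‖x.2‖ₑ⁻¹ * g (x.1 - x.2)) (by fun_prop)
  have hsub : {z | ENNReal.ofReal (2 * A * s ^ (1 - p / 2)) < rieszPotential f z} ⊆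
      {z | ENNReal.ofReal (A * s ^ (1 - p / 2)) ≤ H z} := by
    intro z hz
    by_contra hlt
    have hlt : H z < ENNReal.ofReal (A * s ^ (1 - p / 2)) := not_le.1 hlt
    have := (h f hf hf1 s hs z).trans (add_le_add le_rfl hlt.le)
    rw [← ENNReal.ofReal_add hL.le hL.le, ← two_mul, ← mul_assoc] at this
    exact absurd hz (not_lt.2 this)
  have hHint : ∫⁻ z, H z ≤ ENNReal.ofReal (2 * Real.pi * ρ) *
      ∫⁻ z in {z | ENNReal.ofReal s < f z}, f z := by
    rw [hH, lintegral_lintegral_swap (by fun_prop)]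
    calc _ = ∫⁻ t in Metric.ball (0 : ℂ) ρ, ‖t‖ₑ⁻¹ * ∫⁻ z, g z := by
          refine lintegral_congr fun t => ?_
          rw [lintegral_const_mul _ (by fun_prop), lintegral_sub_right_eq_self g t]
      _ ≤ _ := by
          rw [lintegral_mul_const _ (by fun_prop), hg, lintegral_indicator hms]
          gcongr
          exact setLIntegral_ball_enorm_inv ρ
  calc _ ≤ volume {z | ENNReal.ofReal (A * s ^ (1 - p / 2)) ≤ H z} := measure_mono hsub
    _ ≤ (∫⁻ z, H z) / ENNReal.ofReal (A * s ^ (1 - p / 2)) :=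
        meas_ge_le_lintegral_div hHm.aemeasurable (by simpa using hL) ENNReal.ofReal_ne_top
    _ ≤ (ENNReal.ofReal (2 * Real.pi * ρ) * ∫⁻ z in {z | ENNReal.ofReal s < f z}, f z) /
          ENNReal.ofReal (A * s ^ (1 - p / 2)) := by gcongr
    _ = ENNReal.ofReal (2 * Real.pi * ρ / (A * s ^ (1 - p / 2))) *
          ∫⁻ z in {z | ENNReal.ofReal s < f z}, f z := by
        rw [ENNReal.ofReal_div_of_pos hL, ENNReal.mul_div_right_comm]
    _ ≤ _ := by
        rw [← ENNReal.ofReal_inv_of_pos hs]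
        gcongr
        rw [div_le_iff₀ hL, hρdef]
        calc 2 * Real.pi * s ^ (-p / 2) ≤ A * s ^ (-p / 2) := by gcongr
          _ = s⁻¹ * (A * s ^ (1 - p / 2)) := by
            rw [mul_left_comm, ← Real.rpow_neg_one s, ← Real.rpow_add hs]
            congr 2; ring

/-- The Hardy–Littlewood–Sobolev inequality for the planar Riesz potential of order one. -/
theorem lintegral_rpow_rieszPotential_le {p p' : ℝ} (hp : 1 < p) (hp2 : p < 2)
    (hpp' : 1 / p' = 1 / p - 1 / 2) : ∃ C : ℝ≥0∞, C ≠ ∞ ∧ ∀ f : ℂ → ℝ≥0∞, AEMeasurable f →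
      (∫⁻ z, rieszPotential f z ^ p') ^ (1 / p') ≤ C * (∫⁻ z, f z ^ p) ^ (1 / p) := by
  have hp0 : 0 < p := by linarith
  have he : 0 < 1 - p / 2 := by linarith
  have hp' : p' = p / (1 - p / 2) := by
    have : 1 / p' = (1 - p / 2) / p := by rw [hpp']; field_simp
    rw [← one_div_one_div p', this, one_div_div]
  have hp'0 : 0 < p' := by rw [hp']; positivity
  obtain ⟨A, hA, hweak⟩ := volume_lt_rieszPotential_le hp hp2
  have key : ∀ f : ℂ → ℝ≥0∞, Measurable f → ∫⁻ z, f z ^ p ≤ 1 →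
      ∫⁻ z, rieszPotential f z ^ p' ≤ ENNReal.ofReal (A ^ p' * (p / (p - 1))) := by
    intro f hf hf1
    -- The power is chosen so that {G > s} is the level set of the potential at height A s^(1-p/2).
    -- Because p' = p/(1 - p/2), G^p is a multiple of the potential to the power p'.
    set G : ℂ → ℝ≥0∞ := fun z => ((ENNReal.ofReal A)⁻¹ * rieszPotential f z) ^ (1 / (1 - p / 2))
    have hA' : ENNReal.ofReal A ≠ 0 := by simpa using hA
    have hRm := measurable_rieszPotential hf
    have hG := lintegral_rpow_le_of_meas_lt_le (μ := volume) (f := f) (G := G) hf (by fun_prop) hp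
      (fun s hs => by
        refine (measure_mono fun z hz => ?_).trans (hweak f hf hf1 s hs)
        have hz : ENNReal.ofReal s < ((ENNReal.ofReal A)⁻¹ * rieszPotential f z) ^ (1 / (1 - p / 2)) := hz
        rw [one_div, ENNReal.lt_rpow_inv_iff he, ENNReal.ofReal_rpow_of_pos hs, mul_comm,
          ← div_eq_mul_inv, ENNReal.lt_div_iff_mul_lt (Or.inl hA') (Or.inl ENNReal.ofReal_ne_top),
          ← ENNReal.ofReal_mul (by positivity), mul_comm] at hz
        exact hz)
    have hGp : ∀ z, rieszPotential f z ^ p' = ENNReal.ofReal (A ^ p') * G z ^ p := by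
      intro z
      simp only [G]
      rw [← ENNReal.rpow_mul, one_div, inv_mul_eq_div, ← hp', ← ENNReal.ofReal_rpow_of_pos hA,
        ← ENNReal.mul_rpow_of_nonneg _ _ hp'0.le, ← mul_assoc,
        ENNReal.mul_inv_cancel hA' ENNReal.ofReal_ne_top, one_mul]
    simp_rw [hGp]
    rw [lintegral_const_mul _ (by fun_prop), ENNReal.ofReal_mul (by positivity)]
    gcongr
    exact hG.trans (mul_le_of_le_one_right' hf1)
  refine ⟨(ENNReal.ofReal (A ^ p' * (p / (p - 1)))) ^ (1 / p'),
    ENNReal.rpow_ne_top_of_nonneg (by positivity) ENNReal.ofReal_ne_top, fun f hf => ?_⟩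
  wlog hfm : Measurable f generalizing f
  · have := this (hf.mk f) hf.measurable_mk.aemeasurable hf.measurable_mk
    have hR : ∀ z, rieszPotential f z = rieszPotential (hf.mk f) z :=
      rieszPotential_congr hf.ae_eq_mk
    rw [lintegral_congr_ae (hf.ae_eq_mk.mono fun z hz => congrArg (· ^ p) hz)]
    simp_rw [hR]
    exact this
  -- Homogeneity reduces to norm one, except for the norms 0 and ∞, which cannot be normalized. For
  -- N = ∞ the constant must be seen to be nonzero.
  set N := (∫⁻ z, f z ^ p) ^ (1 / p) with hN
  rcases eq_or_ne N ∞ with hNt | hNt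
  · rw [hNt, ENNReal.mul_top]
    · exact le_top
    · have : 0 < A ^ p' * (p / (p - 1)) := by
        have := sub_pos.2 hp
        positivity
      simp only [ne_eq, ENNReal.rpow_eq_zero_iff, ENNReal.ofReal_eq_zero, ENNReal.ofReal_ne_top]
      simp [this]
  rcases eq_or_ne N 0 with hN0 | hN0
  · have h0 : f =ᵐ[volume] 0 := by
      rw [hN, ENNReal.rpow_eq_zero_iff_of_pos (by positivity),
        lintegral_eq_zero_iff (by fun_prop)] at hN0
      filter_upwards [hN0] with z hz
      simpa [hp0, hp0.not_gt] using hz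
    have hR : ∀ z, rieszPotential f z = 0 := fun z => by
      rw [rieszPotential_congr h0]; simp [rieszPotential]
    simp [hR, hp'0]
  · have hNp : N ^ p = ∫⁻ z, f z ^ p := by
      rw [hN, ← ENNReal.rpow_mul, one_div_mul_cancel hp0.ne', ENNReal.rpow_one]
    have hNi : N⁻¹ ≠ ∞ := ENNReal.inv_ne_top.2 hN0
    have h1 := key (fun z => N⁻¹ * f z) (by fun_prop) (by
      simp_rw [ENNReal.mul_rpow_of_nonneg _ _ hp0.le]
      rw [lintegral_const_mul _ (by fun_prop), ← hNp, ← ENNReal.mul_rpow_of_nonneg _ _ hp0.le,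
        ENNReal.inv_mul_cancel hN0 hNt, ENNReal.one_rpow])
    simp_rw [rieszPotential_const_mul hNi, ENNReal.mul_rpow_of_nonneg _ _ hp'0.le] at h1
    have hRm := measurable_rieszPotential hfm
    rw [lintegral_const_mul _ (by fun_prop)] at h1
    have h2 := ENNReal.rpow_le_rpow h1 (show 0 ≤ 1 / p' by positivity)
    rw [ENNReal.mul_rpow_of_nonneg _ _ (by positivity), ← ENNReal.rpow_mul,
      mul_one_div_cancel hp'0.ne', ENNReal.rpow_one] at h2
    calc _ = N * (N⁻¹ * (∫⁻ z, rieszPotential f z ^ p') ^ (1 / p')) := by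
          rw [← mul_assoc, ENNReal.mul_inv_cancel hN0 hNt, one_mul]
      _ ≤ N * _ := by gcongr
      _ = _ := mul_comm _ _

/-! ### The Cauchy–Pompeiu formula -/

/-- The Wirtinger derivative `∂̄ f = (∂₁ f + i ∂₂ f) / 2`. -/
noncomputable def dbar (f : ℂ → ℂ) (z : ℂ) : ℂ :=
  (1 / 2) * (fderiv ℝ f z 1 + Complex.I * fderiv ℝ f z Complex.I)

theorem integrableOn_polarCoord_target {F : ℝ × ℝ → ℂ} (hF : Continuous F) {R : ℝ}
    (hR : ∀ p : ℝ × ℝ, R ≤ p.1 → F p = 0) : IntegrableOn F polarCoord.target := by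
  have hK : IsCompact (Set.Icc (0 : ℝ) R ×ˢ Set.Icc (-Real.pi) Real.pi) :=
    isCompact_Icc.prod isCompact_Icc
  refine (hF.continuousOn.integrableOn_compact hK).of_forall_sdiff_eq_zero
    polarCoord.open_target.measurableSet fun p hp => hR p ?_
  by_contra hlt
  exact hp.2 ⟨⟨le_of_lt hp.1.1, (not_le.1 hlt).le⟩, ⟨hp.1.2.1.le, hp.1.2.2.le⟩⟩

/-- In polar coordinates ∂̄ = (e^{iθ}/2)(∂_r + (i/r)∂_θ), and the Jacobian r cancels the modulus of
1/t. The radial derivative integrates to -h(0) on every ray, and the angular one to 0 on every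
circle. -/
theorem integral_inv_mul_dbar {h : ℂ → ℂ} (hh : ContDiff ℝ 1 h) (hc : HasCompactSupport h) :
    ∫ t : ℂ, t⁻¹ * dbar h t = -(Real.pi : ℂ) * h 0 := by
  set E : ℝ → ℂ := fun θ => Real.cos θ + Real.sin θ * Complex.I with hE
  have hEc : Continuous E := by fun_prop
  have hEd : ∀ θ, HasDerivAt E (Complex.I * E θ) θ := by
    intro θ
    have h1 := ((Real.hasDerivAt_cos θ).ofReal_comp).add
      (((Real.hasDerivAt_sin θ).ofReal_comp).mul_const Complex.I)
    convert! h1 using 1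
    simp only [hE, mul_add, Complex.ofReal_neg]
    linear_combination (Real.sin θ : ℂ) * Complex.I_mul_I
  have hnorm : ∀ r θ : ℝ, ‖(r : ℂ) * E θ‖ = |r| := fun r θ => by
    have := Complex.norm_polarCoord_symm (r, θ)
    rwa [Complex.polarCoord_symm_apply] at this
  have hD : Continuous (fderiv ℝ h) := hh.continuous_fderiv one_ne_zero
  obtain ⟨R, hR0, hR⟩ := (hc.fderiv ℝ).exists_pos_le_norm
  obtain ⟨R', hR'0, hR'⟩ := hc.exists_pos_le_norm
  have hderiv : ∀ t, HasFDerivAt h (fderiv ℝ h t) t := fun t =>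
    (hh.differentiable one_ne_zero t).hasFDerivAt
  -- F₁ is ∂_r and F₂ is (1/r)∂_θ of h(re^{iθ}), written through the derivative of h so that both
  -- are continuous up to r = 0.
  set F₁ : ℝ × ℝ → ℂ := fun p => fderiv ℝ h (p.1 * E p.2) (E p.2) with hF₁
  set F₂ : ℝ × ℝ → ℂ := fun p => fderiv ℝ h (p.1 * E p.2) (Complex.I * E p.2) with hF₂
  have hF₁c : Continuous F₁ := by fun_prop
  have hF₂c : Continuous F₂ := by fun_prop
  have hzero : ∀ p : ℝ × ℝ, R ≤ p.1 → fderiv ℝ h (p.1 * E p.2) = 0 := fun p hp =>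
    hR _ (by rw [hnorm]; exact hp.trans (le_abs_self _))
  have hF₁i : IntegrableOn F₁ polarCoord.target :=
    integrableOn_polarCoord_target hF₁c (R := R) fun p hp => by simp [hF₁, hzero p hp]
  have hF₂i : IntegrableOn F₂ polarCoord.target :=
    integrableOn_polarCoord_target hF₂c (R := R) fun p hp => by simp [hF₂, hzero p hp]
  have hpt : ∀ p ∈ polarCoord.target, p.1 • ((Complex.polarCoord.symm p)⁻¹ *
      dbar h (Complex.polarCoord.symm p)) = (1 / 2) * F₁ p + (Complex.I / 2) * F₂ p := by
    rintro ⟨r, θ⟩ hp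
    have hr : (r : ℂ) ≠ 0 := by exact_mod_cast (ne_of_gt hp.1 : r ≠ 0)
    have e1 : E θ = Real.cos θ • (1 : ℂ) + Real.sin θ • Complex.I := by simp [hE]
    have e2 : Complex.I * E θ = (-Real.sin θ) • (1 : ℂ) + Real.cos θ • Complex.I := by
      simp only [hE, Complex.real_smul, Complex.ofReal_neg, mul_one]
      linear_combination (Real.sin θ : ℂ) * Complex.I_mul_I
    have e3 : Complex.polarCoord.symm (r, θ) = r * E θ := Complex.polarCoord_symm_apply _
    have e4 : (E θ)⁻¹ = Real.cos θ - Real.sin θ * Complex.I := by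
      refine inv_eq_of_mul_eq_one_right ?_
      have := Real.cos_sq_add_sin_sq θ
      have : (Real.cos θ : ℂ) ^ 2 + (Real.sin θ : ℂ) ^ 2 = 1 := by exact_mod_cast this
      simp only [hE]
      linear_combination this - (Real.sin θ : ℂ) ^ 2 * Complex.I_sq
    simp only [hF₁, hF₂, e3, dbar]
    generalize fderiv ℝ h (r * E θ) = L
    have l1 : L (E θ) = Real.cos θ * L 1 + Real.sin θ * L Complex.I := by
      rw [e1, map_add, map_smul, map_smul]; rfl
    have l2 : L (Complex.I * E θ) = -Real.sin θ * L 1 + Real.cos θ * L Complex.I := by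
      rw [e2, map_add, map_smul, map_smul]; simp
    rw [l1, l2, mul_inv, e4, Complex.real_smul]
    field_simp
    linear_combination (-Real.sin θ : ℂ) * L Complex.I * Complex.I_sq
  rw [← Complex.integral_comp_polarCoord_symm,
    setIntegral_congr_fun polarCoord.open_target.measurableSet hpt,
    integral_add (hF₁i.const_mul _) (hF₂i.const_mul _), integral_const_mul, integral_const_mul]
  rw [polarCoord_target] at hF₁i hF₂i ⊢
  have hI₁ : ∫ p in Set.Ioi (0 : ℝ) ×ˢ Set.Ioo (-Real.pi) Real.pi, F₁ p = -(2 * Real.pi * h 0) := by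
    rw [Measure.volume_eq_prod, IntegrableOn, ← Measure.prod_restrict] at hF₁i
    rw [Measure.volume_eq_prod, ← Measure.prod_restrict, integral_prod_symm _ hF₁i]
    have hr : ∀ θ, ∫ r in Set.Ioi (0 : ℝ), F₁ (r, θ) = -h 0 := by
      intro θ
      have hd : ∀ r : ℝ, HasDerivAt (fun r : ℝ => h (r * E θ)) (F₁ (r, θ)) r := fun r =>
        (hderiv _).comp_hasDerivAt r (by
          simpa using (Complex.ofRealCLM.hasDerivAt (x := r)).mul_const (E θ))
      have hi : IntegrableOn (fun r => F₁ (r, θ)) (Set.Ioi 0) := by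
        refine ((show Continuous fun r => F₁ (r, θ) by fun_prop).continuousOn.integrableOn_compact
          (isCompact_Icc (a := (0 : ℝ)) (b := R))).of_forall_sdiff_eq_zero measurableSet_Ioi
          fun r hr => ?_
        have hRr : R ≤ r := by
          by_contra hlt
          exact hr.2 ⟨le_of_lt hr.1, (not_le.1 hlt).le⟩
        simp [hF₁, hzero (r, θ) hRr]
      rw [integral_Ioi_of_hasDerivAt_of_tendsto' (fun r _ => hd r) hi (m := 0)]
      · simp
      · refine tendsto_const_nhds.congr' ?_
        filter_upwards [Filter.eventually_ge_atTop R'] with r hr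
        exact (hR' _ (by rw [hnorm]; exact hr.trans (le_abs_self _))).symm
    simp_rw [hr]
    rw [setIntegral_const, Measure.real, Real.volume_Ioo, ENNReal.toReal_ofReal (by
      linarith [Real.pi_pos]), Complex.real_smul]
    push_cast
    ring
  have hI₂ : ∫ p in Set.Ioi (0 : ℝ) ×ˢ Set.Ioo (-Real.pi) Real.pi, F₂ p = 0 := by
    rw [Measure.volume_eq_prod, setIntegral_prod _ hF₂i]
    refine setIntegral_eq_zero_of_forall_eq_zero fun r hr => ?_
    have hr0 : (r : ℂ) ≠ 0 := by exact_mod_cast (ne_of_gt hr : r ≠ 0)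
    have hd : ∀ θ : ℝ, HasDerivAt (fun θ : ℝ => (r : ℂ)⁻¹ * h (r * E θ)) (F₂ (r, θ)) θ := by
      intro θ
      have h1 := ((hderiv (r * E θ)).comp_hasDerivAt θ ((hEd θ).const_mul (r : ℂ))).const_mul
        ((r : ℂ)⁻¹)
      convert! h1 using 1
      have h2 := (fderiv ℝ h (r * E θ)).map_smul r (Complex.I * E θ)
      rw [Complex.real_smul, Complex.real_smul] at h2
      rw [h2, inv_mul_cancel_left₀ hr0]
    rw [← setIntegral_congr_set Ioo_ae_eq_Ioc.symm,
      ← intervalIntegral.integral_of_le (by linarith [Real.pi_pos]),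
      intervalIntegral.integral_eq_sub_of_hasDerivAt (fun θ _ => hd θ)
        (Continuous.intervalIntegrable (by fun_prop) _ _)]
    simp [hE]
  rw [hI₁, hI₂]
  ring

theorem cauchyOp_dbar {g : ℂ → ℂ} (hg : ContDiff ℝ 1 g) (hc : HasCompactSupport g) (z : ℂ) :
    cauchyOp (dbar g) z = g z := by
  have hh : ContDiff ℝ 1 (fun t => g (z - t)) := hg.comp (contDiff_const.sub contDiff_id)
  have hhc : HasCompactSupport (fun t => g (z - t)) :=
    hc.comp_homeomorph (Homeomorph.subLeft z)
  have hd : ∀ t, dbar (fun t => g (z - t)) t = -dbar g (z - t) := by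
    intro t
    have h1 : HasFDerivAt (fun t => g (z - t)) (-(fderiv ℝ g (z - t))) t := by
      have := ((hg.differentiable one_ne_zero (z - t)).hasFDerivAt).comp t
        ((hasFDerivAt_id t).const_sub z)
      convert! this using 1
      ext
      simp
    simp only [dbar, h1.fderiv, neg_apply]
    ring
  have key := integral_inv_mul_dbar hh hhc
  simp only [hd, sub_zero] at key
  have hpi : (Real.pi : ℂ) ≠ 0 := by exact_mod_cast Real.pi_ne_zero
  calc cauchyOp (dbar g) z = ∫ t, -(Real.pi : ℂ)⁻¹ * (t⁻¹ * -dbar g (z - t)) := by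
        rw [cauchyOp, convolution_def]
        refine integral_congr_ae (ae_of_all _ fun t => ?_)
        simp only [ContinuousLinearMap.mul_apply', one_div, mul_inv]
        ring
    _ = g z := by
        rw [integral_const_mul, key]
        field_simp

/-! ### Hardy–Littlewood–Sobolev, Hölder and Sobolev in reciprocal exponents; norms of the weight -/

/-- Exponents are parametrized by their reciprocals: Hölder becomes addition, and the reciprocal 0
stands for L^∞. -/
theorem eLpNorm_inv_ofReal {α E : Type*} [MeasurableSpace α] {μ : Measure α}
    [TopologicalSpace E] [ContinuousENorm E] {a : ℝ} (ha : 0 < a) (f : α → E) :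
    eLpNorm f (ENNReal.ofReal a)⁻¹ μ = (∫⁻ x, ‖f x‖ₑ ^ (1 / a) ∂μ) ^ (1 / (1 / a)) := by
  rw [eLpNorm_eq_lintegral_rpow_enorm_toReal (by simp) (by simpa using ha), ENNReal.toReal_inv,
    ENNReal.toReal_ofReal ha.le, one_div a]

/-- The Hardy–Littlewood–Sobolev inequality in terms of the reciprocal exponents. -/
theorem exists_eLpNorm_rieszPotential_le {a : ℝ} (ha : 0 < a) (ha2 : a < 1 / 2) :
    ∃ C : ℝ≥0∞, C ≠ ∞ ∧ ∀ f : ℂ → ℝ≥0∞, AEMeasurable f →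
      eLpNorm (rieszPotential f) (ENNReal.ofReal a)⁻¹ volume
        ≤ C * eLpNorm f (ENNReal.ofReal (1 / 2 + a))⁻¹ volume := by
  obtain ⟨C, hC, h⟩ := lintegral_rpow_rieszPotential_le (p := 1 / (1 / 2 + a)) (p' := 1 / a)
    (by rw [lt_div_iff₀ (by linarith)]; linarith) (by rw [div_lt_iff₀ (by linarith)]; linarith)
    (by rw [one_div_one_div, one_div_one_div]; ring)
  refine ⟨C, hC, fun f hf => ?_⟩
  rw [eLpNorm_inv_ofReal ha, eLpNorm_inv_ofReal (by linarith)]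
  simpa only [enorm_eq_self] using h f hf

/-- The regularized weight `(|z - z₀|² + r²)^(-1/2)`. -/
noncomputable def regWeight (r : ℝ) (z₀ z : ℂ) : ℝ := (√(‖z - z₀‖ ^ 2 + r ^ 2))⁻¹

theorem continuous_regWeight {r : ℝ} (hr : 0 < r) (z₀ : ℂ) : Continuous (regWeight r z₀) :=
  Continuous.inv₀ (by fun_prop) fun z => by positivity

theorem regWeight_nonneg (r : ℝ) (z₀ z : ℂ) : 0 ≤ regWeight r z₀ z := by
  unfold regWeight; positivity

theorem enorm_regWeight_le_inv {r : ℝ} (hr : 0 < r) (z₀ z : ℂ) :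
    ‖regWeight r z₀ z‖ₑ ≤ ENNReal.ofReal r⁻¹ := by
  rw [← ofReal_norm, Real.norm_of_nonneg (regWeight_nonneg _ _ _)]
  refine ENNReal.ofReal_le_ofReal (inv_anti₀ hr (Real.le_sqrt_of_sq_le ?_))
  nlinarith [sq_nonneg ‖z - z₀‖]

theorem enorm_regWeight_le_enorm_inv {r : ℝ} (z₀ z : ℂ) :
    ‖regWeight r z₀ z‖ₑ ≤ ‖z - z₀‖ₑ⁻¹ := by
  rcases eq_or_ne (z - z₀) 0 with h | h
  · simp [h]
  have hz : 0 < ‖z - z₀‖ := norm_pos_iff.2 h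
  rw [← ofReal_norm, Real.norm_of_nonneg (regWeight_nonneg _ _ _), ← ofReal_norm,
    ← ENNReal.ofReal_inv_of_pos hz]
  refine ENNReal.ofReal_le_ofReal (inv_anti₀ hz (Real.le_sqrt_of_sq_le ?_))
  nlinarith [sq_nonneg r]

/-- The weight is at most 1/r on the ball of radius r about z₀ and at most 1/|z - z₀| outside, where
the power 1/θ > 2 is integrable. The case θ = 0 is the sup bound, needed at the endpoint 1/q = 1/2 +
1/p*. -/
theorem exists_eLpNorm_regWeight_le {θ : ℝ} (hθ : 0 ≤ θ) (hθ2 : θ < 1 / 2) :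
    ∃ C : ℝ≥0∞, C ≠ ∞ ∧ ∀ r : ℝ, 0 < r → ∀ z₀ : ℂ,
      eLpNorm (regWeight r z₀) (ENNReal.ofReal θ)⁻¹ volume ≤ C * ENNReal.ofReal (r ^ (2 * θ - 1)) := by
  rcases hθ.eq_or_lt with rfl | hθ0
  · refine ⟨1, ENNReal.one_ne_top, fun r hr z₀ => ?_⟩
    rw [ENNReal.ofReal_zero, ENNReal.inv_zero, eLpNorm_exponent_top, one_mul, mul_zero, zero_sub,
      Real.rpow_neg_one]
    exact eLpNormEssSup_le_of_ae_enorm_bound (ae_of_all _ (enorm_regWeight_le_inv hr z₀))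
  set b := 1 / θ with hb
  have hb0 : 0 < b := by positivity
  have hb2 : 2 < b := by rw [hb, lt_div_iff₀ hθ0]; linarith
  set D := Real.pi + 2 * Real.pi / (b - 2) with hD
  have hD1 : 0 ≤ 2 * Real.pi / (b - 2) := div_nonneg (by positivity) (by linarith)
  refine ⟨ENNReal.ofReal (D ^ (1 / b)), ENNReal.ofReal_ne_top, fun r hr z₀ => ?_⟩
  have hI : ∫⁻ z, ‖regWeight r z₀ z‖ₑ ^ b ≤ ENNReal.ofReal (D * r ^ (2 - b)) := by
    have h0 : ∀ z, regWeight r z₀ z = regWeight r 0 (z - z₀) := fun z => by simp [regWeight]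
    simp_rw [h0]
    rw [lintegral_sub_right_eq_self (fun z => ‖regWeight r 0 z‖ₑ ^ b) z₀,
      ← lintegral_add_compl _ (measurableSet_ball (x := (0 : ℂ)) (ε := r)), hD, add_mul,
      ENNReal.ofReal_add (by positivity) (by positivity)]
    refine add_le_add ?_ ?_
    · calc _ ≤ ∫⁻ _ in Metric.ball (0 : ℂ) r, ENNReal.ofReal r⁻¹ ^ b :=
            lintegral_mono fun z => ENNReal.rpow_le_rpow (enorm_regWeight_le_inv hr 0 z) hb0.le
        _ = _ := by
            rw [setLIntegral_const, Complex.volume_ball, ENNReal.ofReal_rpow_of_pos (by positivity),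
              ← ENNReal.ofReal_pow hr.le, ← ENNReal.ofReal_coe_nnreal,
              ← ENNReal.ofReal_mul (by positivity), ← ENNReal.ofReal_mul (by positivity),
              NNReal.coe_real_pi, Real.inv_rpow hr.le, Real.rpow_sub hr, Real.rpow_two]
            congr 1
            field_simp
    · refine (lintegral_mono fun z => ENNReal.rpow_le_rpow ?_ hb0.le).trans
        (setLIntegral_compl_ball_enorm_inv_rpow hr hb2)
      simpa using enorm_regWeight_le_enorm_inv (r := r) 0 z
  rw [eLpNorm_inv_ofReal hθ0, ← hb]
  refine (ENNReal.rpow_le_rpow hI (by positivity)).trans (le_of_eq ?_)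
  rw [ENNReal.ofReal_rpow_of_nonneg (by positivity) (by positivity),
    Real.mul_rpow (by positivity) (by positivity), ← Real.rpow_mul hr.le,
    ENNReal.ofReal_mul (by positivity)]
  congr 3
  rw [hb]
  field_simp

theorem ofReal_inv_holderTriple {a b c : ℝ} (ha : 0 ≤ a) (hb : 0 ≤ b) (h : a + b = c) :
    ENNReal.HolderTriple (ENNReal.ofReal a)⁻¹ (ENNReal.ofReal b)⁻¹ (ENNReal.ofReal c)⁻¹ :=
  ⟨by rw [inv_inv, inv_inv, inv_inv, ← h, ENNReal.ofReal_add ha hb]⟩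

/-- Hölder's inequality in terms of the reciprocal exponents. -/
theorem eLpNorm_smul_le_of_add_eq {α E : Type*} [MeasurableSpace α] {μ : Measure α}
    [NormedAddCommGroup E] [NormedSpace ℝ E] {a b c : ℝ} (ha : 0 ≤ a) (hb : 0 ≤ b) (h : a + b = c)
    {w : α → ℝ} {f : α → E} (hw : AEStronglyMeasurable w μ) (hf : AEStronglyMeasurable f μ) :
    eLpNorm (fun x => w x • f x) (ENNReal.ofReal c)⁻¹ μ ≤
      eLpNorm w (ENNReal.ofReal a)⁻¹ μ * eLpNorm f (ENNReal.ofReal b)⁻¹ μ :=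
  haveI := ofReal_inv_holderTriple ha hb h
  eLpNorm_smul_le_mul_eLpNorm hf hw

/-- Gagliardo–Nirenberg–Sobolev in real dimension 2, with q = 1/b: the bounds on b say 1 ≤ q < 2. -/
theorem exists_eLpNorm_le_eLpNorm_fderiv {b : ℝ} (hb : 1 / 2 < b) (hb1 : b ≤ 1) :
    ∃ C : ℝ≥0∞, C ≠ ∞ ∧ ∀ u : ℂ → ℂ, ContDiff ℝ 1 u → HasCompactSupport u →
      eLpNorm u (ENNReal.ofReal (b - 1 / 2))⁻¹ volume ≤
        C * eLpNorm (fderiv ℝ u) (ENNReal.ofReal b)⁻¹ volume := by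
  have hb0 : 0 < b := by linarith
  have hcoe : ∀ x : ℝ, 0 < x → (ENNReal.ofReal x)⁻¹ = ((Real.toNNReal x)⁻¹ : NNReal) := fun x hx => by
    rw [ENNReal.coe_inv (by simpa using hx)]; rfl
  refine ⟨SNormLESNormFDerivOfEqConst ℂ (volume : Measure ℂ) ((Real.toNNReal b)⁻¹ : NNReal),
    ENNReal.coe_ne_top, fun u hu hc => ?_⟩
  rw [hcoe b hb0, hcoe (b - 1 / 2) (by linarith)]
  refine eLpNorm_le_eLpNorm_fderiv_of_eq volume hu hc ?_ (by simp) ?_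
  · rw [one_le_inv₀ (by simpa using hb0)]
    simpa using hb1
  · rw [Complex.finrank_real_complex]
    simp only [NNReal.coe_inv, Real.coe_toNNReal _ hb0.le, inv_inv]
    rw [Real.coe_toNNReal _ (by linarith)]
    norm_num

/-! ### Calculus of ∂̄ for the oscillating factor and the regularized multiplier -/

theorem dbar_mul {f g : ℂ → ℂ} {z : ℂ} (hf : DifferentiableAt ℝ f z)
    (hg : DifferentiableAt ℝ g z) :
    dbar (fun w => f w * g w) z = dbar f z * g z + f z * dbar g z := by
  have h : HasFDerivAt (fun w => f w * g w) (f z • fderiv ℝ g z + g z • fderiv ℝ f z) z :=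
    hf.hasFDerivAt.mul hg.hasFDerivAt
  simp only [dbar, h.fderiv, add_apply, smul_apply, smul_eq_mul]
  ring

theorem dbar_cexp {f : ℂ → ℂ} {z : ℂ} (hf : DifferentiableAt ℝ f z) :
    dbar (fun w => Complex.exp (f w)) z = Complex.exp (f z) * dbar f z := by
  simp only [dbar, hf.hasFDerivAt.cexp.fderiv, smul_apply, smul_eq_mul]
  ring

theorem dbar_inv {f : ℂ → ℂ} {z : ℂ} (hf : DifferentiableAt ℝ f z) (h0 : f z ≠ 0) :
    dbar (fun w => (f w)⁻¹) z = -dbar f z * ((f z)⁻¹) ^ 2 := by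
  have h : HasFDerivAt (fun w => (f w)⁻¹) (-((f z) ^ 2)⁻¹ • fderiv ℝ f z) z :=
    (hasDerivAt_inv h0).comp_hasFDerivAt z hf.hasFDerivAt
  simp only [dbar, h.fderiv, smul_apply, smul_eq_mul]
  field_simp
  ring

theorem dbar_add_const (f : ℂ → ℂ) (c z : ℂ) : dbar (fun w => f w + c) z = dbar f z := by
  simp only [dbar, fderiv_add_const]

theorem dbar_add {f g : ℂ → ℂ} {z : ℂ} (hf : DifferentiableAt ℝ f z)
    (hg : DifferentiableAt ℝ g z) :
    dbar (fun w => f w + g w) z = dbar f z + dbar g z := by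
  have h : HasFDerivAt (fun w => f w + g w) (fderiv ℝ f z + fderiv ℝ g z) z :=
    hf.hasFDerivAt.add hg.hasFDerivAt
  simp only [dbar, h.fderiv, add_apply]
  ring

theorem dbar_const (c z : ℂ) : dbar (fun _ => c) z = 0 := by
  simp [dbar]

theorem dbar_sub_const (z₀ z : ℂ) : dbar (fun w => w - z₀) z = 0 := by
  have : HasFDerivAt (fun w : ℂ => w - z₀) (ContinuousLinearMap.id ℝ ℂ) z :=
    (hasFDerivAt_id z).sub_const z₀
  simp [dbar, this.fderiv]

theorem dbar_conj_sub_const (z₀ z : ℂ) : dbar (fun w => (starRingEnd ℂ) (w - z₀)) z = 1 := by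
  have : HasFDerivAt (fun w : ℂ => (starRingEnd ℂ) (w - z₀)) (Complex.conjCLE : ℂ →L[ℝ] ℂ) z :=
    (Complex.conjCLE : ℂ →L[ℝ] ℂ).hasFDerivAt.comp z ((hasFDerivAt_id z).sub_const z₀)
  rw [dbar, this.fderiv]
  simp
  norm_num

/-- The oscillating factor `exp (-i τ (Φ + conj Φ))`. -/
noncomputable def oscFactor (τ : ℝ) (z₀ z : ℂ) : ℂ :=
  Complex.exp (-Complex.I * (τ : ℂ) * (phase z₀ z + (starRingEnd ℂ) (phase z₀ z)))

theorem modulate_eq (τ : ℝ) (z₀ : ℂ) (a : ℂ → ℂ) (z : ℂ) :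
    modulate τ z₀ a z = oscFactor τ z₀ z * a z := rfl

theorem norm_oscFactor (τ : ℝ) (z₀ z : ℂ) : ‖oscFactor τ z₀ z‖ = 1 := by
  rw [oscFactor, Complex.add_conj, mul_assoc, neg_mul, ← mul_neg, mul_comm, ← Complex.ofReal_mul,
    ← Complex.ofReal_neg, Complex.norm_exp_ofReal_mul_I]

theorem contDiff_conj_sub_const {n : WithTop ℕ∞} (z₀ : ℂ) :
    ContDiff ℝ n (fun w => (starRingEnd ℂ) (w - z₀)) :=
  (Complex.conjCLE : ℂ →L[ℝ] ℂ).contDiff.comp (contDiff_id.sub contDiff_const)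

theorem oscFactor_eq (τ : ℝ) (z₀ : ℂ) : oscFactor τ z₀ = fun z => Complex.exp
    (-Complex.I * (τ : ℂ) * ((z - z₀) * (z - z₀) +
      (starRingEnd ℂ) (z - z₀) * (starRingEnd ℂ) (z - z₀))) := by
  funext z
  rw [oscFactor, phase, map_pow, sq, sq]

theorem contDiff_oscFactor {n : WithTop ℕ∞} (τ : ℝ) (z₀ : ℂ) : ContDiff ℝ n (oscFactor τ z₀) := by
  have := contDiff_conj_sub_const (n := n) z₀
  rw [oscFactor_eq]
  fun_prop

/-- Φ is holomorphic, so only conj Φ contributes. The factor conj(z - z₀), vanishing at the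
stationary point, is what the multiplier has to compensate. -/
theorem dbar_oscFactor (τ : ℝ) (z₀ z : ℂ) : dbar (oscFactor τ z₀) z =
    -2 * Complex.I * τ * (starRingEnd ℂ) (z - z₀) * oscFactor τ z₀ z := by
  have h1 : DifferentiableAt ℝ (fun w => (starRingEnd ℂ) (w - z₀)) z :=
    (contDiff_conj_sub_const (n := 1) z₀).differentiable one_ne_zero z
  have h2 : DifferentiableAt ℝ (fun w : ℂ => w - z₀) z := by fun_prop
  rw [oscFactor_eq, dbar_cexp (by fun_prop), dbar_mul (by fun_prop) (by fun_prop), dbar_const,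
    dbar_add (by fun_prop) (by fun_prop), dbar_mul h2 h2, dbar_mul h1 h1, dbar_sub_const,
    dbar_conj_sub_const]
  ring

/-- The multiplier `(z - z₀) / (|z - z₀|² + r²)`, a regularization of `1 / conj (z - z₀)`. -/
noncomputable def regMultiplier (r : ℝ) (z₀ z : ℂ) : ℂ :=
  (z - z₀) * ((z - z₀) * (starRingEnd ℂ) (z - z₀) + (r : ℂ) ^ 2)⁻¹

theorem mul_conj_add_sq_eq (r : ℝ) (z₀ z : ℂ) :
    (z - z₀) * (starRingEnd ℂ) (z - z₀) + (r : ℂ) ^ 2 = ((‖z - z₀‖ ^ 2 + r ^ 2 : ℝ) : ℂ) := by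
  rw [Complex.mul_conj, Complex.normSq_eq_norm_sq]
  push_cast
  rfl

theorem mul_conj_add_sq_ne_zero {r : ℝ} (hr : 0 < r) (z₀ z : ℂ) :
    (z - z₀) * (starRingEnd ℂ) (z - z₀) + (r : ℂ) ^ 2 ≠ 0 := by
  rw [mul_conj_add_sq_eq]
  exact_mod_cast (by positivity : ‖z - z₀‖ ^ 2 + r ^ 2 ≠ 0)

theorem contDiff_regMultiplier {n : WithTop ℕ∞} {r : ℝ} (hr : 0 < r) (z₀ : ℂ) :
    ContDiff ℝ n (regMultiplier r z₀) := by
  have := contDiff_conj_sub_const (n := n) z₀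
  exact ContDiff.mul (by fun_prop) (ContDiff.inv (by fun_prop) (mul_conj_add_sq_ne_zero hr z₀))

/-- With u = z - z₀ the multiplier is u/(u conj u + r²), and ∂̄ acts only on conj u. The
regularization thus keeps the identity valid for 1/conj u away from its pole. -/
theorem dbar_regMultiplier {r : ℝ} (hr : 0 < r) (z₀ z : ℂ) :
    dbar (regMultiplier r z₀) z = -(regMultiplier r z₀ z) ^ 2 := by
  have h1 : DifferentiableAt ℝ (fun w => (starRingEnd ℂ) (w - z₀)) z :=
    (contDiff_conj_sub_const (n := 1) z₀).differentiable one_ne_zero z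
  have h2 : DifferentiableAt ℝ (fun w : ℂ => w - z₀) z := by fun_prop
  have h0 := mul_conj_add_sq_ne_zero hr z₀ z
  have h3 : DifferentiableAt ℝ
      (fun w : ℂ => (w - z₀) * (starRingEnd ℂ) (w - z₀) + (r : ℂ) ^ 2) z := by fun_prop
  unfold regMultiplier
  have h4 : DifferentiableAt ℝ
      (fun w : ℂ => ((w - z₀) * (starRingEnd ℂ) (w - z₀) + (r : ℂ) ^ 2)⁻¹) z := h3.inv h0
  rw [dbar_mul h2 h4, dbar_inv h3 h0, dbar_add_const, dbar_mul h2 h1, dbar_sub_const,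
    dbar_conj_sub_const]
  ring

theorem norm_regMultiplier_le {r : ℝ} (hr : 0 < r) (z₀ z : ℂ) :
    ‖regMultiplier r z₀ z‖ ≤ regWeight r z₀ z := by
  have hp : 0 < ‖z - z₀‖ ^ 2 + r ^ 2 := by positivity
  rw [regMultiplier, mul_conj_add_sq_eq, norm_mul, norm_inv, Complex.norm_real,
    Real.norm_of_nonneg hp.le, regWeight, ← div_eq_mul_inv, div_le_iff₀ hp, inv_mul_eq_div,
    Real.div_sqrt]
  exact Real.le_sqrt_of_sq_le (by nlinarith [sq_nonneg r])

theorem regWeight_sq {r : ℝ} (z₀ z : ℂ) :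
    regWeight r z₀ z ^ 2 = (‖z - z₀‖ ^ 2 + r ^ 2)⁻¹ := by
  rw [regWeight, inv_pow, Real.sq_sqrt (by positivity)]

/-! ### Integration by parts against the phase -/

/-- Up to an error controlled by the regularized weight, the modulated function is a
`∂̄`-derivative. -/
theorem norm_modulate_sub_dbar_le {τ r : ℝ} (hτ : 0 < τ) (hr : 0 < r) (hτr : τ * r ^ 2 = 1)
    (z₀ : ℂ) {φ : ℂ → ℂ} {z : ℂ} (hφ : DifferentiableAt ℝ φ z) :
    ‖modulate τ z₀ φ z - Complex.I / (2 * τ) *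
        dbar (fun w => oscFactor τ z₀ w * (regMultiplier r z₀ w * φ w)) z‖
      ≤ (2 * τ)⁻¹ * (3 * (regWeight r z₀ z * (regWeight r z₀ z * ‖φ z‖))
        + regWeight r z₀ z * ‖dbar φ z‖) := by
  have hE : DifferentiableAt ℝ (oscFactor τ z₀) z :=
    (contDiff_oscFactor (n := 1) τ z₀).differentiable one_ne_zero z
  have hm : DifferentiableAt ℝ (regMultiplier r z₀) z :=
    (contDiff_regMultiplier (n := 1) hr z₀).differentiable one_ne_zero z
  have h0 := mul_conj_add_sq_ne_zero hr z₀ z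
  have hτc : (τ : ℂ) ≠ 0 := by exact_mod_cast hτ.ne'
  have hτrc : (τ : ℂ) * (r : ℂ) ^ 2 = 1 := by exact_mod_cast hτr
  -- The multiplier inverts conj(z - z₀) only up to r²w². After multiplication by τ this defect is
  -- w², since τr² = 1: the same size as the term coming from the derivative of m.
  have hcm : (starRingEnd ℂ) (z - z₀) * regMultiplier r z₀ z
      = 1 - (r : ℂ) ^ 2 * (regWeight r z₀ z : ℂ) ^ 2 := by
    have : (regWeight r z₀ z : ℂ) ^ 2
        = ((z - z₀) * (starRingEnd ℂ) (z - z₀) + (r : ℂ) ^ 2)⁻¹ := by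
      rw [mul_conj_add_sq_eq, ← Complex.ofReal_pow, regWeight_sq, Complex.ofReal_inv]
    rw [this, regMultiplier]
    field_simp
    ring
  have key : modulate τ z₀ φ z - Complex.I / (2 * τ) *
        dbar (fun w => oscFactor τ z₀ w * (regMultiplier r z₀ w * φ w)) z
      = oscFactor τ z₀ z * ((2 * (τ : ℂ))⁻¹ * (2 * (regWeight r z₀ z : ℂ) ^ 2 * φ z +
          Complex.I * (regMultiplier r z₀ z ^ 2 * φ z - regMultiplier r z₀ z * dbar φ z))) := by
    rw [dbar_mul hE (by fun_prop), dbar_mul hm hφ, dbar_oscFactor, dbar_regMultiplier hr,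
      modulate_eq]
    have e1 : -2 * Complex.I * τ * (starRingEnd ℂ) (z - z₀) * oscFactor τ z₀ z *
        (regMultiplier r z₀ z * φ z) = -2 * Complex.I * oscFactor τ z₀ z * φ z *
          (τ - (regWeight r z₀ z : ℂ) ^ 2) := by
      linear_combination (-2 * Complex.I * τ * oscFactor τ z₀ z * φ z) * hcm +
        2 * Complex.I * oscFactor τ z₀ z * φ z * (regWeight r z₀ z : ℂ) ^ 2 * hτrc
    rw [e1]
    field_simp
    linear_combination (2 * oscFactor τ z₀ z * φ z * (τ - (regWeight r z₀ z : ℂ) ^ 2)) * Complex.I_sq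
  have hw := regWeight_nonneg r z₀ z
  have hM := norm_regMultiplier_le hr z₀ z
  rw [key, norm_mul, norm_oscFactor, one_mul, norm_mul, norm_inv, norm_mul, Complex.norm_real,
    Complex.norm_two, Real.norm_of_nonneg hτ.le]
  gcongr
  calc _ ≤ ‖2 * (regWeight r z₀ z : ℂ) ^ 2 * φ z‖ + ‖Complex.I *
        (regMultiplier r z₀ z ^ 2 * φ z - regMultiplier r z₀ z * dbar φ z)‖ := norm_add_le _ _
    _ ≤ 2 * regWeight r z₀ z ^ 2 * ‖φ z‖ + (regWeight r z₀ z ^ 2 * ‖φ z‖ +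
        regWeight r z₀ z * ‖dbar φ z‖) := by
        refine add_le_add ?_ ?_
        · simp [abs_of_nonneg hw]
        · rw [norm_mul, Complex.norm_I, one_mul]
          refine (norm_sub_le _ _).trans ?_
          rw [norm_mul, norm_mul, norm_pow]
          gcongr
    _ = _ := by ring

theorem enorm_cauchyKernel_mul_le (t v : ℂ) :
    ‖ContinuousLinearMap.mul ℂ ℂ (1 / ((Real.pi : ℂ) * t)) v‖ₑ ≤ ‖t‖ₑ⁻¹ * ‖v‖ₑ := by
  rw [ContinuousLinearMap.mul_apply', enorm_mul]
  refine mul_le_mul' ?_ le_rfl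
  rcases eq_or_ne t 0 with rfl | ht
  · simp
  have ht' : 0 < ‖t‖ := norm_pos_iff.2 ht
  rw [← ofReal_norm, ← ofReal_norm, ← ENNReal.ofReal_inv_of_pos ht', norm_div, norm_mul, norm_one,
    Complex.norm_real, Real.norm_of_nonneg Real.pi_pos.le, one_div]
  refine ENNReal.ofReal_le_ofReal (inv_anti₀ ht' ?_)
  nlinarith [Real.pi_gt_three]

theorem enorm_cauchyOp_le (u : ℂ → ℂ) (z : ℂ) :
    ‖cauchyOp u z‖ₑ ≤ rieszPotential (fun w => ‖u w‖ₑ) z := by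
  rw [cauchyOp, convolution_def]
  exact (enorm_integral_le_lintegral_enorm _).trans
    (lintegral_mono fun t => enorm_cauchyKernel_mul_le t _)

theorem measurable_cauchyKernel : Measurable fun z : ℂ => 1 / ((Real.pi : ℂ) * z) := by fun_prop

theorem CauchyOpExistsAt.of_rieszPotential_lt_top {u : ℂ → ℂ} (hu : AEStronglyMeasurable u volume)
    {z : ℂ} (hz : rieszPotential (fun w => ‖u w‖ₑ) z < ∞) : CauchyOpExistsAt u z :=
  ⟨AEStronglyMeasurable.convolution_integrand_snd (ContinuousLinearMap.mul ℂ ℂ)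
      measurable_cauchyKernel.aestronglyMeasurable hu z,
    (lintegral_mono fun t => enorm_cauchyKernel_mul_le t _).trans_lt hz⟩

theorem aestronglyMeasurable_cauchyOp {u : ℂ → ℂ} (hu : AEStronglyMeasurable u volume) :
    AEStronglyMeasurable (cauchyOp u) volume :=
  (AEStronglyMeasurable.convolution_integrand (ContinuousLinearMap.mul ℂ ℂ) (μ := volume)
    measurable_cauchyKernel.aestronglyMeasurable hu).integral_prod_right'

theorem cauchyOp_congr {u v : ℂ → ℂ} (h : u =ᵐ[volume] v) : cauchyOp u = cauchyOp v :=
  convolution_congr _ Filter.EventuallyEq.rfl h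

theorem locallyIntegrable_cauchyKernel :
    LocallyIntegrable (fun z : ℂ => 1 / ((Real.pi : ℂ) * z)) volume := by
  refine locallyIntegrable_iff.2 fun K hK => ?_
  obtain ⟨R, hR⟩ := hK.isBounded.subset_ball 0
  refine IntegrableOn.mono_set ⟨measurable_cauchyKernel.aestronglyMeasurable, ?_⟩ hR
  refine lt_of_le_of_lt (lintegral_mono fun t => ?_)
    ((setLIntegral_ball_enorm_inv R).trans_lt ENNReal.ofReal_lt_top)
  simpa using enorm_cauchyKernel_mul_le t 1

theorem cauchyOpExistsAt_of_continuous {u : ℂ → ℂ} (hu : Continuous u) (hc : HasCompactSupport u)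
    (z : ℂ) : CauchyOpExistsAt u z :=
  hc.convolutionExists_right _ locallyIntegrable_cauchyKernel hu z

theorem norm_dbar_le (f : ℂ → ℂ) (z : ℂ) : ‖dbar f z‖ ≤ ‖fderiv ℝ f z‖ := by
  have h1 := (fderiv ℝ f z).le_opNorm 1
  have h2 := (fderiv ℝ f z).le_opNorm Complex.I
  rw [norm_one, mul_one] at h1
  rw [Complex.norm_I, mul_one] at h2
  calc ‖dbar f z‖ ≤ 1 / 2 * (‖fderiv ℝ f z 1‖ + ‖fderiv ℝ f z Complex.I‖) := by
        rw [dbar, norm_mul]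
        gcongr
        · norm_num
        · refine (norm_add_le _ _).trans ?_
          rw [norm_mul, Complex.norm_I, one_mul]
    _ ≤ _ := by linarith

theorem continuous_dbar {f : ℂ → ℂ} (hf : ContDiff ℝ 1 f) : Continuous (dbar f) := by
  have := hf.continuous_fderiv one_ne_zero
  unfold dbar
  fun_prop

theorem hasCompactSupport_dbar {f : ℂ → ℂ} (hc : HasCompactSupport f) :
    HasCompactSupport (dbar f) :=
  (hc.fderiv ℝ).comp_left (g := fun L : ℂ →L[ℝ] ℂ => 1 / 2 * (L 1 + Complex.I * L Complex.I))
    (by simp)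

/-- The Cauchy operator recovers the exact ∂̄-derivative through Cauchy–Pompeiu, and the remainder
is dominated by a Riesz potential. -/
theorem enorm_conjCauchyOp_le {τ r : ℝ} (hτ : 0 < τ) (hr : 0 < r) (hτr : τ * r ^ 2 = 1)
    (z₀ : ℂ) {φ : ℂ → ℂ} (hφ : ContDiff ℝ 1 φ) (hc : HasCompactSupport φ) (z : ℂ) :
    ‖conjCauchyOp τ z₀ φ z‖ₑ ≤ ENNReal.ofReal (2 * τ)⁻¹ * (‖regWeight r z₀ z • φ z‖ₑ +
      rieszPotential (fun w => 3 * ‖regWeight r z₀ w • (regWeight r z₀ w • φ w)‖ₑ +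
        ‖regWeight r z₀ w • dbar φ w‖ₑ) z) := by
  set g : ℂ → ℂ := fun w => oscFactor τ z₀ w * (regMultiplier r z₀ w * φ w) with hg
  have hgd : ContDiff ℝ 1 g :=
    (contDiff_oscFactor τ z₀).mul ((contDiff_regMultiplier hr z₀).mul hφ)
  have hgc : HasCompactSupport g := (hc.mul_left).mul_left
  set c : ℂ := Complex.I / (2 * τ) with hcdef
  have hcn : ‖c‖ₑ = ENNReal.ofReal (2 * τ)⁻¹ := by
    rw [← ofReal_norm, hcdef, norm_div, norm_mul, Complex.norm_I, Complex.norm_two,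
      Complex.norm_real, Real.norm_of_nonneg hτ.le, one_div]
  set h : ℂ → ℂ := fun w => modulate τ z₀ φ w - c * dbar g w with hh
  have hdc : Continuous fun w => c * dbar g w := continuous_const.mul (continuous_dbar hgd)
  have hds : HasCompactSupport fun w => c * dbar g w := (hasCompactSupport_dbar hgc).mul_left
  have hmc : Continuous (modulate τ z₀ φ) :=
    (contDiff_oscFactor (n := 1) τ z₀).continuous.mul hφ.continuous
  have hms : HasCompactSupport (modulate τ z₀ φ) := hc.mul_left
  have hsplit : conjCauchyOp τ z₀ φ z = c * g z + cauchyOp h z := by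
    have h1 : modulate τ z₀ φ = (fun w => c * dbar g w) + h := by
      funext w; simp [hh]
    have h2 : cauchyOp (fun w => c * dbar g w) z = c * g z := by
      rw [← cauchyOp_dbar hgd hgc z]
      exact congrFun (convolution_smul (y := c) (g := dbar g)) z
    rw [conjCauchyOp, h1, ← h2]
    exact ConvolutionExistsAt.distrib_add (cauchyOpExistsAt_of_continuous hdc hds z)
      (cauchyOpExistsAt_of_continuous (hmc.sub hdc) (hms.sub hds) z)
  have hgn : ‖g z‖ₑ ≤ ‖regWeight r z₀ z • φ z‖ₑ := by
    rw [enorm_le_iff_norm_le, hg, norm_mul, norm_oscFactor, one_mul, norm_mul, norm_smul,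
      Real.norm_of_nonneg (regWeight_nonneg _ _ _)]
    gcongr
    exact norm_regMultiplier_le hr z₀ z
  have hhn : ∀ w, ‖h w‖ₑ ≤ ENNReal.ofReal (2 * τ)⁻¹ *
      (3 * ‖regWeight r z₀ w • (regWeight r z₀ w • φ w)‖ₑ + ‖regWeight r z₀ w • dbar φ w‖ₑ) := by
    intro w
    have hw := regWeight_nonneg r z₀ w
    have := norm_modulate_sub_dbar_le hτ hr hτr z₀ (hφ.differentiable one_ne_zero w)
    rw [← ofReal_norm, ← ofReal_norm, ← ofReal_norm, norm_smul, norm_smul, norm_smul,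
      Real.norm_of_nonneg hw, show (3 : ℝ≥0∞) = ENNReal.ofReal 3 by simp,
      ← ENNReal.ofReal_mul (by norm_num), ← ENNReal.ofReal_add (by positivity) (by positivity),
      ← ENNReal.ofReal_mul (by positivity)]
    exact ENNReal.ofReal_le_ofReal this
  rw [hsplit, mul_add]
  refine (enorm_add_le _ _).trans (add_le_add ?_ ?_)
  · rw [enorm_mul, hcn]
    exact mul_le_mul' le_rfl hgn
  · refine (enorm_cauchyOp_le h z).trans ((rieszPotential_mono hhn z).trans ?_)
    rw [rieszPotential_const_mul ENNReal.ofReal_ne_top]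

/-! ### The decay estimate on the whole plane -/

theorem one_le_inv_ofReal {a : ℝ} (ha : a ≤ 1) : 1 ≤ (ENNReal.ofReal a)⁻¹ := by
  rw [ENNReal.one_le_inv]
  simpa using ha

/-- The decay estimate for the conjugated Cauchy operator on compactly supported functions, in terms
of the reciprocal exponents `a = 1 / p*`, `b = 1 / q`. -/
theorem exists_eLpNorm_conjCauchyOp_le {a b : ℝ} (ha : 0 < a) (ha2 : a < 1 / 2) (hb : 1 / 2 < b)
    (hba : b ≤ 1 / 2 + a) : ∃ C : ℝ≥0∞, C ≠ ∞ ∧ ∀ τ : ℝ, 0 < τ → ∀ z₀ : ℂ, ∀ φ : ℂ → ℂ,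
      ContDiff ℝ 1 φ → HasCompactSupport φ →
      eLpNorm (conjCauchyOp τ z₀ φ) (ENNReal.ofReal a)⁻¹ volume ≤
        C * ENNReal.ofReal (τ ^ (b - 1 - a)) *
          eLpNorm (fderiv ℝ φ) (ENNReal.ofReal b)⁻¹ volume := by
  obtain ⟨C₁, hC₁, hHLS⟩ := exists_eLpNorm_rieszPotential_le ha ha2
  -- One weight must lift b - 1/2 to a, or b to 1/2 + a: either gap is 1/2 + a - b. Two weights lift
  -- b - 1/2 to 1/2 + a, so each receives half of 1 + a - b, which is below 1/2 because a < b.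
  obtain ⟨C₂, hC₂, hw⟩ := exists_eLpNorm_regWeight_le (θ := 1 / 2 + a - b) (by linarith)
    (by linarith)
  obtain ⟨C₃, hC₃, hw'⟩ := exists_eLpNorm_regWeight_le (θ := (1 + a - b) / 2) (by linarith)
    (by linarith)
  obtain ⟨C₄, hC₄, hGNS⟩ := exists_eLpNorm_le_eLpNorm_fderiv hb (by linarith)
  refine ⟨C₂ * C₄ + C₁ * (3 * (C₃ * (C₃ * C₄)) + C₂), by finiteness, fun τ hτ z₀ φ hφ hc => ?_⟩
  -- At this scale r^(2θ-1) is τ^(b-a) for the single weight and τ^((b-a)/2) for each of the two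
  -- weights, so all terms have the same power of τ.
  set r := τ ^ (-(1 / 2) : ℝ) with hrdef
  have hr : 0 < r := Real.rpow_pos_of_pos hτ _
  have hτr : τ * r ^ 2 = 1 := by
    rw [hrdef, ← Real.rpow_natCast, ← Real.rpow_mul hτ.le, show -(1 / 2) * ((2 : ℕ) : ℝ) = -1 by
      norm_num, Real.rpow_neg_one, mul_inv_cancel₀ hτ.ne']
  set N := eLpNorm (fderiv ℝ φ) (ENNReal.ofReal b)⁻¹ volume with hN
  set P := ENNReal.ofReal (τ ^ (b - a)) with hP
  have hw1 : eLpNorm (regWeight r z₀) (ENNReal.ofReal (1 / 2 + a - b))⁻¹ volume ≤ C₂ * P := by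
    convert hw r hr z₀ using 3
    rw [hrdef, ← Real.rpow_mul hτ.le]
    congr 1; ring
  have hw2 : eLpNorm (regWeight r z₀) (ENNReal.ofReal ((1 + a - b) / 2))⁻¹ volume ≤
      C₃ * ENNReal.ofReal (τ ^ ((b - a) / 2)) := by
    convert hw' r hr z₀ using 3
    rw [hrdef, ← Real.rpow_mul hτ.le]
    congr 1; ring
  have hwm : AEStronglyMeasurable (regWeight r z₀) volume :=
    (continuous_regWeight hr z₀).aestronglyMeasurable
  have hφm : AEStronglyMeasurable φ volume := hφ.continuous.aestronglyMeasurable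
  have hdm : AEStronglyMeasurable (dbar φ) volume := (continuous_dbar hφ).aestronglyMeasurable
  have hG := hGNS φ hφ hc
  have hd : eLpNorm (dbar φ) (ENNReal.ofReal b)⁻¹ volume ≤ N := eLpNorm_mono (norm_dbar_le φ)
  have t1 : eLpNorm (fun z => regWeight r z₀ z • φ z) (ENNReal.ofReal a)⁻¹ volume ≤
      C₂ * P * (C₄ * N) :=
    (eLpNorm_smul_le_of_add_eq (a := 1 / 2 + a - b) (b := b - 1 / 2) (by linarith) (by linarith)
      (by ring) hwm hφm).trans (mul_le_mul' hw1 hG)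
  have t2 : eLpNorm (fun z => regWeight r z₀ z • (regWeight r z₀ z • φ z))
      (ENNReal.ofReal (1 / 2 + a))⁻¹ volume ≤ C₃ * ENNReal.ofReal (τ ^ ((b - a) / 2)) *
        (C₃ * ENNReal.ofReal (τ ^ ((b - a) / 2)) * (C₄ * N)) := by
    refine (eLpNorm_smul_le_of_add_eq (a := (1 + a - b) / 2) (b := (1 + a - b) / 2 + (b - 1 / 2))
      (by linarith) (by linarith) (by ring) hwm (hwm.smul hφm)).trans (mul_le_mul' hw2 ?_)
    exact (eLpNorm_smul_le_of_add_eq (by linarith) (by linarith) rfl hwm hφm).trans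
      (mul_le_mul' hw2 hG)
  have t3 : eLpNorm (fun z => regWeight r z₀ z • dbar φ z)
      (ENNReal.ofReal (1 / 2 + a))⁻¹ volume ≤ C₂ * P * N :=
    (eLpNorm_smul_le_of_add_eq (a := 1 / 2 + a - b) (b := b) (by linarith) (by linarith)
      (by ring) hwm hdm).trans (mul_le_mul' hw1 hd)
  have hPP : ENNReal.ofReal (τ ^ ((b - a) / 2)) * ENNReal.ofReal (τ ^ ((b - a) / 2)) = P := by
    rw [← ENNReal.ofReal_mul (by positivity), ← Real.rpow_add hτ, add_halves]
  have t2' : eLpNorm (fun z => regWeight r z₀ z • (regWeight r z₀ z • φ z))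
      (ENNReal.ofReal (1 / 2 + a))⁻¹ volume ≤ C₃ * (C₃ * C₄) * P * N := by
    refine t2.trans (le_of_eq ?_)
    rw [← hPP]; ring
  set f : ℂ → ℝ≥0∞ := fun w => 3 * ‖regWeight r z₀ w • (regWeight r z₀ w • φ w)‖ₑ +
        ‖regWeight r z₀ w • dbar φ w‖ₑ with hf
  have hm2 : AEMeasurable (fun w => 3 * ‖regWeight r z₀ w • (regWeight r z₀ w • φ w)‖ₑ) volume :=
    (hwm.smul (hwm.smul hφm)).enorm.const_mul 3
  have hm3 : AEMeasurable (fun w => ‖regWeight r z₀ w • dbar φ w‖ₑ) volume :=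
    (hwm.smul hdm).enorm
  have hfm : AEMeasurable f volume := hm2.add hm3
  have hfn : eLpNorm f (ENNReal.ofReal (1 / 2 + a))⁻¹ volume ≤
      (3 * (C₃ * (C₃ * C₄)) + C₂) * P * N := by
    refine (eLpNorm_add_le hm2.aestronglyMeasurable hm3.aestronglyMeasurable
      (one_le_inv_ofReal (by linarith))).trans ?_
    have h3 : eLpNorm (fun w => 3 * ‖regWeight r z₀ w • (regWeight r z₀ w • φ w)‖ₑ)
        (ENNReal.ofReal (1 / 2 + a))⁻¹ volume ≤ (3 : NNReal) •
          eLpNorm (fun z => regWeight r z₀ z • (regWeight r z₀ z • φ z))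
            (ENNReal.ofReal (1 / 2 + a))⁻¹ volume :=
      eLpNorm_le_nnreal_smul_eLpNorm_of_ae_le_mul' (ae_of_all _ fun w => by simp) _
    calc _ ≤ 3 * (C₃ * (C₃ * C₄) * P * N) + C₂ * P * N := by
          refine add_le_add (h3.trans ?_) ?_
          · rw [ENNReal.smul_def, smul_eq_mul]
            exact mul_le_mul' le_rfl t2'
          · rw [eLpNorm_enorm]
            exact t3
      _ = _ := by ring
  have hRm : AEStronglyMeasurable (rieszPotential f) volume := by
    have : rieszPotential f = rieszPotential (hfm.mk f) :=
      funext (rieszPotential_congr hfm.ae_eq_mk)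
    rw [this]
    exact (measurable_rieszPotential hfm.measurable_mk).aestronglyMeasurable
  have hfin : eLpNorm (conjCauchyOp τ z₀ φ) (ENNReal.ofReal a)⁻¹ volume ≤
      ENNReal.ofReal (2 * τ)⁻¹ * eLpNorm (fun z => ‖regWeight r z₀ z • φ z‖ₑ +
        rieszPotential f z) (ENNReal.ofReal a)⁻¹ volume :=
    eLpNorm_le_mul_eLpNorm_of_ae_le_mul'' _
      ((hwm.smul hφm).enorm.aestronglyMeasurable.add hRm) (ae_of_all _ fun z => by
      rw [enorm_eq_self]
      exact enorm_conjCauchyOp_le hτ hr hτr z₀ hφ hc z)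
  have hτ' : ENNReal.ofReal (2 * τ)⁻¹ * P ≤ ENNReal.ofReal (τ ^ (b - 1 - a)) := by
    rw [hP, ← ENNReal.ofReal_mul (by positivity)]
    refine ENNReal.ofReal_le_ofReal ?_
    rw [show b - 1 - a = -1 + (b - a) by ring, Real.rpow_add hτ, Real.rpow_neg_one]
    gcongr
    linarith
  calc _ ≤ ENNReal.ofReal (2 * τ)⁻¹ * (C₂ * P * (C₄ * N) +
        C₁ * ((3 * (C₃ * (C₃ * C₄)) + C₂) * P * N)) := by
        refine hfin.trans (mul_le_mul' le_rfl ?_)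
        refine (eLpNorm_add_le (hwm.smul hφm).enorm.aestronglyMeasurable hRm
          (one_le_inv_ofReal (by linarith))).trans (add_le_add ?_ ?_)
        · rw [eLpNorm_enorm]
          exact t1
        · exact (hHLS f hfm).trans (mul_le_mul' le_rfl hfn)
    _ = (C₂ * C₄ + C₁ * (3 * (C₃ * (C₃ * C₄)) + C₂)) * (ENNReal.ofReal (2 * τ)⁻¹ * P) * N := by
        ring
    _ ≤ _ := by gcongr

/-! ### Boundedness and almost everywhere convergence of the Cauchy integral -/

theorem exists_eLpNorm_cauchyOp_le {a : ℝ} (ha : 0 < a) (ha2 : a < 1 / 2) :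
    ∃ C : ℝ≥0∞, C ≠ ∞ ∧ ∀ u : ℂ → ℂ, AEStronglyMeasurable u volume →
      eLpNorm (cauchyOp u) (ENNReal.ofReal a)⁻¹ volume
        ≤ C * eLpNorm u (ENNReal.ofReal (1 / 2 + a))⁻¹ volume := by
  obtain ⟨C, hC, h⟩ := exists_eLpNorm_rieszPotential_le ha ha2
  refine ⟨C, hC, fun u hu => ?_⟩
  rw [← eLpNorm_enorm u]
  exact (eLpNorm_mono_enorm fun z => by
    rw [enorm_eq_self]; exact enorm_cauchyOp_le u z).trans (h _ hu.enorm)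

/-- The Riesz potential of |u| has finite norm by Hardy–Littlewood–Sobolev, hence is finite almost
everywhere, and it dominates the integral of the absolute value. -/
theorem ae_cauchyOpExistsAt {a : ℝ} (ha : 0 < a) (ha2 : a < 1 / 2) {u : ℂ → ℂ}
    (hu : MemLp u (ENNReal.ofReal (1 / 2 + a))⁻¹ volume) : ∀ᵐ z, CauchyOpExistsAt u z := by
  obtain ⟨C, hC, h⟩ := exists_eLpNorm_rieszPotential_le ha ha2
  have hu' := hu.1.enorm
  set R := rieszPotential (fun w => ‖u w‖ₑ) with hR
  have hRm : Measurable R := by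
    have : R = rieszPotential (hu'.mk _) := funext (rieszPotential_congr hu'.ae_eq_mk)
    rw [this]
    exact measurable_rieszPotential hu'.measurable_mk
  have hlt : (∫⁻ z, R z ^ (1 / a)) ^ (1 / (1 / a)) < ∞ := by
    have h1 := h _ hu'
    rw [eLpNorm_enorm, eLpNorm_inv_ofReal ha] at h1
    simp only [enorm_eq_self] at h1
    exact h1.trans_lt (ENNReal.mul_lt_top hC.lt_top hu.2)
  rw [ENNReal.rpow_lt_top_iff_of_pos (by positivity)] at hlt
  filter_upwards [ae_lt_top (hRm.pow_const _) hlt.ne] with z hz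
  rw [ENNReal.rpow_lt_top_iff_of_pos (by positivity)] at hz
  exact CauchyOpExistsAt.of_rieszPotential_lt_top hu.1 hz

theorem norm_modulate (τ : ℝ) (z₀ : ℂ) (u : ℂ → ℂ) (z : ℂ) : ‖modulate τ z₀ u z‖ = ‖u z‖ := by
  rw [modulate_eq, norm_mul, norm_oscFactor, one_mul]

theorem eLpNorm_modulate (τ : ℝ) (z₀ : ℂ) (u : ℂ → ℂ) (p : ℝ≥0∞) :
    eLpNorm (modulate τ z₀ u) p volume = eLpNorm u p volume :=
  eLpNorm_congr_norm_ae (ae_of_all _ (norm_modulate τ z₀ u))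

theorem aestronglyMeasurable_modulate (τ : ℝ) (z₀ : ℂ) {u : ℂ → ℂ}
    (hu : AEStronglyMeasurable u volume) : AEStronglyMeasurable (modulate τ z₀ u) volume :=
  (contDiff_oscFactor (n := 1) τ z₀).continuous.aestronglyMeasurable.mul hu

theorem modulate_congr (τ : ℝ) (z₀ : ℂ) {u v : ℂ → ℂ} (h : u =ᵐ[volume] v) :
    modulate τ z₀ u =ᵐ[volume] modulate τ z₀ v :=
  h.mono fun z hz => by rw [modulate_eq, modulate_eq, hz]

theorem conjCauchyOp_congr (τ : ℝ) (z₀ : ℂ) {u v : ℂ → ℂ} (h : u =ᵐ[volume] v) :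
    conjCauchyOp τ z₀ u = conjCauchyOp τ z₀ v :=
  cauchyOp_congr (modulate_congr τ z₀ h)

/-! ### Extension to W₀^{1,q}(X) -/

section W10

variable {q : ℝ≥0∞} [Fact (1 ≤ q)] {X : Opens ℂ}

theorem aestronglyMeasurable_extendByZero (u : W10 q X) :
    AEStronglyMeasurable (extendByZero u) volume :=
  (aestronglyMeasurable_indicator_iff X.isOpen.measurableSet).2 (Lp.aestronglyMeasurable _)

theorem enorm_apply_le (u : W10 q X) (j : Fin 3) : ‖u.1 j‖ₑ ≤ ‖u‖ₑ := by
  rw [enorm_le_iff_norm_le]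
  exact PiLp.norm_apply_le u.1 j

theorem eLpNorm_extendByZero_le {p : ℝ≥0∞} (hpq : p ≤ q) (u : W10 q X) :
    eLpNorm (extendByZero u) p volume ≤
      volume (X : Set ℂ) ^ (1 / p.toReal - 1 / q.toReal) * ‖u‖ₑ := by
  rw [extendByZero, eLpNorm_indicator_eq_eLpNorm_restrict X.isOpen.measurableSet]
  refine (eLpNorm_le_eLpNorm_mul_rpow_measure_univ hpq (Lp.aestronglyMeasurable _)).trans ?_
  rw [Measure.restrict_apply_univ, mul_comm, ← Lp.enorm_def]
  exact mul_le_mul' le_rfl (enorm_apply_le u 0)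

theorem ae_eq_extendByZero {u : W10 q X} {f : ℂ → ℂ}
    (h : (u.1 0 : LpOn q X) =ᵐ[volume.restrict (X : Set ℂ)] f) (hf : ∀ z ∉ X, f z = 0) :
    extendByZero u =ᵐ[volume] f := by
  filter_upwards [(ae_restrict_iff' X.isOpen.measurableSet).1 h] with z hz
  by_cases hzX : z ∈ (X : Set ℂ)
  · rw [extendByZero, Set.indicator_of_mem hzX, hz hzX]
  · rw [extendByZero, Set.indicator_of_notMem hzX, hf z hzX]

theorem extendByZero_of_notMem (u : W10 q X) {z : ℂ} (hz : z ∉ X) : extendByZero u z = 0 :=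
  Set.indicator_of_notMem hz _

theorem ae_extendByZero (u : W10 q X) :
    (u.1 0 : LpOn q X) =ᵐ[volume.restrict (X : Set ℂ)] extendByZero u := by
  filter_upwards [ae_restrict_mem X.isOpen.measurableSet] with z hz
  rw [extendByZero, Set.indicator_of_mem hz]

theorem extendByZero_add (u v : W10 q X) :
    extendByZero (u + v) =ᵐ[volume] extendByZero u + extendByZero v := by
  refine ae_eq_extendByZero ?_ fun z hz => by
    simp [extendByZero_of_notMem _ hz]
  exact (Lp.coeFn_add (u.1 0) (v.1 0)).trans ((ae_extendByZero u).add (ae_extendByZero v))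

theorem extendByZero_smul (c : ℂ) (u : W10 q X) :
    extendByZero (c • u) =ᵐ[volume] c • extendByZero u := by
  refine ae_eq_extendByZero ?_ fun z hz => by
    simp [extendByZero_of_notMem _ hz]
  exact (Lp.coeFn_smul c (u.1 0)).trans ((ae_extendByZero u).const_smul c)

theorem jet_eq_zero_of_notMem (φ : 𝓓(X, ℂ)) (j : Fin 3) {z : ℂ} (hz : z ∉ X) : jet φ j z = 0 := by
  have ht : z ∉ tsupport φ := fun h => hz (φ.tsupport_subset h)
  have hd : fderiv ℝ φ z = 0 := fderiv_of_notMem_tsupport (𝕜 := ℝ) ht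
  fin_cases j
  · exact image_eq_zero_of_notMem_tsupport ht
  · simp [jet, hd]
  · simp [jet, hd]

theorem extendByZero_ofTest (φ : 𝓓(X, ℂ)) : extendByZero (W10.ofTest q X φ) =ᵐ[volume] φ :=
  ae_eq_extendByZero (MemLp.coeFn_toLp (jet_memLp q φ 0)) fun _ hz => jet_eq_zero_of_notMem φ 0 hz

theorem eLpNorm_jet_le (φ : 𝓓(X, ℂ)) (j : Fin 3) :
    eLpNorm (jet φ j) q volume ≤ ‖W10.ofTest q X φ‖ₑ := by
  have h : jet φ j = (X : Set ℂ).indicator (jet φ j) :=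
    (Set.indicator_eq_self.2 fun z hz => by
      by_contra hzX
      exact hz (jet_eq_zero_of_notMem φ j hzX)).symm
  rw [h, eLpNorm_indicator_eq_eLpNorm_restrict X.isOpen.measurableSet,
    ← Lp.enorm_toLp (jet_memLp q φ j)]
  exact enorm_apply_le (W10.ofTest q X φ) j

theorem norm_le_norm_apply_one_add_norm_apply_I (L : ℂ →L[ℝ] ℂ) :
    ‖L‖ ≤ ‖L 1‖ + ‖L Complex.I‖ := by
  refine L.opNorm_le_bound (by positivity) fun v => ?_
  have hv : v = v.re • (1 : ℂ) + v.im • Complex.I := by simp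
  have hL : L v = v.re • L 1 + v.im • L Complex.I := by
    nth_rewrite 1 [hv]
    rw [map_add, map_smul, map_smul]
  rw [hL, add_mul]
  refine (norm_add_le _ _).trans (add_le_add ?_ ?_)
  · rw [norm_smul, mul_comm]
    exact mul_le_mul_of_nonneg_left (Complex.abs_re_le_norm v) (norm_nonneg _)
  · rw [norm_smul, mul_comm]
    exact mul_le_mul_of_nonneg_left (Complex.abs_im_le_norm v) (norm_nonneg _)

theorem eLpNorm_fderiv_testFunction_le (φ : 𝓓(X, ℂ)) :
    eLpNorm (fderiv ℝ φ) q volume ≤ 2 * ‖W10.ofTest q X φ‖ₑ := by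
  have hd : Continuous (fderiv ℝ φ) := φ.contDiff.continuous_fderiv (by simp)
  have hm : ∀ v : ℂ, AEStronglyMeasurable (fun z => ‖fderiv ℝ φ z v‖) volume := fun v =>
    (hd.clm_apply continuous_const).norm.aestronglyMeasurable
  calc eLpNorm (fderiv ℝ φ) q volume
      ≤ eLpNorm ((fun z => ‖fderiv ℝ φ z 1‖) + fun z => ‖fderiv ℝ φ z Complex.I‖) q volume :=
        eLpNorm_mono_real fun z => norm_le_norm_apply_one_add_norm_apply_I _
    _ ≤ _ := eLpNorm_add_le (hm 1) (hm Complex.I) Fact.out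
    _ ≤ ‖W10.ofTest q X φ‖ₑ + ‖W10.ofTest q X φ‖ₑ := by
        rw [eLpNorm_norm, eLpNorm_norm]
        exact add_le_add (eLpNorm_jet_le φ 1) (eLpNorm_jet_le φ 2)
    _ = _ := (two_mul _).symm

theorem denseRange_ofTest : DenseRange (W10.ofTest q X) := by
  intro u
  rw [closure_subtype, ← Set.range_comp]
  exact u.2

/-- Boundedness of the conjugated Cauchy operator on `W₀^{1,q}(X)`, without decay in `τ`. -/
theorem exists_conjCauchyOp_clm {a : ℝ} (ha : 0 < a) (ha2 : a < 1 / 2)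
    [Fact (1 ≤ (ENNReal.ofReal a)⁻¹)] (hq : (ENNReal.ofReal (1 / 2 + a))⁻¹ ≤ q)
    (hX : Bornology.IsBounded (X : Set ℂ)) (τ : ℝ) (z₀ : ℂ) :
    ∃ T : W10 q X →L[ℂ] LpOn (ENNReal.ofReal a)⁻¹ X, ∀ u : W10 q X,
      (∀ᵐ z, CauchyOpExistsAt (modulate τ z₀ (extendByZero u)) z) ∧
      T u =ᵐ[volume.restrict (X : Set ℂ)] conjCauchyOp τ z₀ (extendByZero u) := by
  obtain ⟨C, hC, hCle⟩ := exists_eLpNorm_cauchyOp_le ha ha2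
  set p := (ENNReal.ofReal (1 / 2 + a))⁻¹ with hp
  set V := volume (X : Set ℂ) ^ (1 / p.toReal - 1 / q.toReal) with hV
  have hV' : V ≠ ∞ := by
    refine ENNReal.rpow_ne_top_of_nonneg ?_ hX.measure_lt_top.ne
    rw [one_div, one_div, ← ENNReal.toReal_inv, ← ENNReal.toReal_inv, sub_nonneg]
    exact ENNReal.toReal_mono (by simp [hp]) (ENNReal.inv_le_inv.2 hq)
  have hm : ∀ u : W10 q X, AEStronglyMeasurable (modulate τ z₀ (extendByZero u)) volume := fun u =>
    aestronglyMeasurable_modulate τ z₀ (aestronglyMeasurable_extendByZero u)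
  have hLp : ∀ u : W10 q X, MemLp (modulate τ z₀ (extendByZero u)) p volume := fun u =>
    ⟨hm u, by
      rw [eLpNorm_modulate]
      exact (eLpNorm_extendByZero_le hq u).trans_lt (ENNReal.mul_lt_top hV'.lt_top enorm_lt_top)⟩
  have hb : ∀ u : W10 q X, eLpNorm (conjCauchyOp τ z₀ (extendByZero u)) (ENNReal.ofReal a)⁻¹
      (volume.restrict (X : Set ℂ)) ≤ C * V * ‖u‖ₑ := fun u => by
    refine (eLpNorm_mono_measure _ Measure.restrict_le_self).trans ((hCle _ (hm u)).trans ?_)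
    rw [eLpNorm_modulate, mul_assoc]
    exact mul_le_mul' le_rfl (eLpNorm_extendByZero_le hq u)
  have hmem : ∀ u : W10 q X, MemLp (conjCauchyOp τ z₀ (extendByZero u)) (ENNReal.ofReal a)⁻¹
      (volume.restrict (X : Set ℂ)) := fun u =>
    ⟨(aestronglyMeasurable_cauchyOp (hm u)).restrict, (hb u).trans_lt
      (ENNReal.mul_lt_top (ENNReal.mul_lt_top hC.lt_top hV'.lt_top) enorm_lt_top)⟩
  have hex : ∀ u : W10 q X, ∀ᵐ z, CauchyOpExistsAt (modulate τ z₀ (extendByZero u)) z := fun u =>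
    ae_cauchyOpExistsAt ha ha2 (hLp u)
  let T₀ : W10 q X →ₗ[ℂ] LpOn (ENNReal.ofReal a)⁻¹ X :=
    { toFun := fun u => (hmem u).toLp _
      -- Additivity is available only where both integrals converge absolutely, which is almost
      -- everywhere and so enough for classes in L^{p*}.
      map_add' := fun u v => by
        rw [← MemLp.toLp_add, MemLp.toLp_eq_toLp_iff, conjCauchyOp_congr τ z₀ (extendByZero_add u v)]
        filter_upwards [ae_restrict_of_ae (hex u), ae_restrict_of_ae (hex v)] with z hu hv
        have h : modulate τ z₀ (extendByZero u + extendByZero v) =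
            modulate τ z₀ (extendByZero u) + modulate τ z₀ (extendByZero v) := by
          funext w
          simp only [modulate_eq, Pi.add_apply, mul_add]
        rw [conjCauchyOp, h]
        exact ConvolutionExistsAt.distrib_add hu hv
      map_smul' := fun c u => by
        rw [RingHom.id_apply, ← MemLp.toLp_const_smul, MemLp.toLp_eq_toLp_iff,
          conjCauchyOp_congr τ z₀ (extendByZero_smul c u)]
        have h : modulate τ z₀ (c • extendByZero u) = c • modulate τ z₀ (extendByZero u) := by
          funext w
          simp only [modulate_eq, Pi.smul_apply, smul_eq_mul]
          ring
        rw [conjCauchyOp, h]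
        exact Filter.EventuallyEq.of_eq convolution_smul }
  refine ⟨T₀.mkContinuous (C * V).toReal fun u => ?_, fun u => ⟨hex u, (hmem u).coeFn_toLp⟩⟩
  have := ENNReal.toReal_mono (by finiteness) (hb u)
  rw [ENNReal.toReal_mul, toReal_enorm] at this
  exact (Lp.norm_toLp _ (hmem u)).trans_le this

end W10

/-- The two `Fact`s only make `L^q(X)` and `L^{p*}(X)` normed spaces; they follow from the
hypotheses `h1`, `h3` on the exponents (which give `1 < q < 2 < p*`). -/
theorem lemma4p3 (X : Opens ℂ) (hX : Bornology.IsBounded (X : Set ℂ))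
    (pStar q : ℝ≥0∞) [Fact (1 ≤ pStar)] [Fact (1 ≤ q)]
    (h1 : 2 < pStar) (h2 : pStar < ∞) (h3 : 1 / q ≤ 1 / 2 + 1 / pStar) (h4 : 1 / 2 < 1 / q) :
    ∃ C : ℝ, ∀ τ : ℝ, 1 < τ → ∀ z₀ : ℂ, ∃ T : W10 q X →L[ℂ] LpOn pStar X,
      (∀ φ : 𝓓(X, ℂ), T (W10.ofTest q X φ)
        =ᵐ[volume.restrict (X : Set ℂ)] conjCauchyOp τ z₀ φ) ∧
      (∀ a : W10 q X, ∀ᵐ z ∂(volume.restrict (X : Set ℂ)),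
        CauchyOpExistsAt (modulate τ z₀ (extendByZero a)) z ∧ T a z = conjCauchyOp τ z₀ (extendByZero a) z) ∧
      (∀ a : W10 q X,
        ‖T a‖ ≤ C * τ ^ (1 / q.toReal - 1 - 1 / pStar.toReal) * ‖a‖) := by
  -- Passing to reciprocal exponents turns the hypotheses into linear inequalities between real
  -- numbers.
  obtain ⟨a, ha, rfl⟩ : ∃ a : ℝ, 0 < a ∧ pStar = (ENNReal.ofReal a)⁻¹ := by
    have : 0 < pStar.toReal := ENNReal.toReal_pos (by positivity) h2.ne
    exact ⟨pStar.toReal⁻¹, by positivity, by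
      rw [ENNReal.ofReal_inv_of_pos this, inv_inv, ENNReal.ofReal_toReal h2.ne]⟩
  have hq0 : q ≠ 0 := (zero_lt_one.trans_le (Fact.out : 1 ≤ q)).ne'
  have hqt : q ≠ ∞ := by rintro rfl; simp at h4
  obtain ⟨b, hb0, rfl⟩ : ∃ b : ℝ, 0 < b ∧ q = (ENNReal.ofReal b)⁻¹ := by
    have : 0 < q.toReal := ENNReal.toReal_pos hq0 hqt
    exact ⟨q.toReal⁻¹, by positivity, by
      rw [ENNReal.ofReal_inv_of_pos this, inv_inv, ENNReal.ofReal_toReal hqt]⟩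
  have hhalf : (1 / 2 : ℝ≥0∞) = ENNReal.ofReal (1 / 2) := by
    rw [ENNReal.ofReal_div_of_pos two_pos]; simp
  have ha2 : a < 1 / 2 := by
    rw [ENNReal.lt_inv_iff_lt_inv, ← one_div, hhalf] at h1
    exact (ENNReal.ofReal_lt_ofReal_iff (by norm_num)).1 h1
  have hb : 1 / 2 < b := by
    rw [one_div (ENNReal.ofReal b)⁻¹, inv_inv, hhalf] at h4
    exact (ENNReal.ofReal_lt_ofReal_iff hb0).1 h4
  have hba : b ≤ 1 / 2 + a := by
    rw [one_div (ENNReal.ofReal b)⁻¹, inv_inv, one_div (ENNReal.ofReal a)⁻¹, inv_inv, hhalf,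
      ← ENNReal.ofReal_add (by norm_num) ha.le] at h3
    exact (ENNReal.ofReal_le_ofReal_iff (by positivity)).1 h3
  have hexp : ∀ τ : ℝ, τ ^ (1 / (ENNReal.ofReal b)⁻¹.toReal - 1 - 1 / (ENNReal.ofReal a)⁻¹.toReal)
      = τ ^ (b - 1 - a) := fun τ => by
    rw [ENNReal.toReal_inv, ENNReal.toReal_inv, ENNReal.toReal_ofReal hb0.le,
      ENNReal.toReal_ofReal ha.le, one_div, one_div, inv_inv, inv_inv]
  obtain ⟨C, hC, hCle⟩ := exists_eLpNorm_conjCauchyOp_le ha ha2 hb hba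
  -- C comes from the whole-plane estimate, so it involves neither τ, z₀ nor X. The factor 2 bounds
  -- the operator norm of the derivative by the two partial derivatives.
  refine ⟨(C * 2).toReal, fun τ hτ z₀ => ?_⟩
  have hτ0 : 0 < τ := zero_lt_one.trans hτ
  obtain ⟨T, hT⟩ := exists_conjCauchyOp_clm (q := (ENNReal.ofReal b)⁻¹) (X := X) ha ha2
    (ENNReal.inv_le_inv.2 (ENNReal.ofReal_le_ofReal hba)) hX τ z₀
  have htest : ∀ φ : 𝓓(X, ℂ), T (W10.ofTest (ENNReal.ofReal b)⁻¹ X φ)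
      =ᵐ[volume.restrict (X : Set ℂ)] conjCauchyOp τ z₀ φ := fun φ => by
    rw [← conjCauchyOp_congr τ z₀ (extendByZero_ofTest (q := (ENNReal.ofReal b)⁻¹) φ)]
    exact (hT _).2
  refine ⟨T, htest, fun u => ?_, fun u => ?_⟩
  · filter_upwards [ae_restrict_of_ae (hT u).1, (hT u).2] with z hz1 hz2 using ⟨hz1, hz2⟩
  · rw [hexp]
    -- T is already continuous, so the set where the decay estimate holds is closed and test
    -- functions suffice.
    refine DenseRange.induction_on (denseRange_ofTest (q := (ENNReal.ofReal b)⁻¹) (X := X)) u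
      (isClosed_le (by fun_prop) (by fun_prop)) fun φ => ?_
    have h : ‖T (W10.ofTest (ENNReal.ofReal b)⁻¹ X φ)‖ₑ ≤
        C * 2 * ENNReal.ofReal (τ ^ (b - 1 - a)) * ‖W10.ofTest (ENNReal.ofReal b)⁻¹ X φ‖ₑ := by
      rw [Lp.enorm_def, eLpNorm_congr_ae (htest φ)]
      refine (eLpNorm_mono_measure _ Measure.restrict_le_self).trans
        ((hCle τ hτ0 z₀ φ (φ.contDiff.of_le (by simp)) φ.hasCompactSupport).trans ?_)
      calc _ ≤ C * ENNReal.ofReal (τ ^ (b - 1 - a)) *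
            (2 * ‖W10.ofTest (ENNReal.ofReal b)⁻¹ X φ‖ₑ) :=
            mul_le_mul' le_rfl (eLpNorm_fderiv_testFunction_le φ)
        _ = _ := by ring
    have h' := ENNReal.toReal_mono (by finiteness) h
    rwa [ENNReal.toReal_mul, ENNReal.toReal_mul, ENNReal.toReal_ofReal (by positivity),
      toReal_enorm, toReal_enorm] at h'
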